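/- Let $d\ge 2$ and let $E=[a_1,b_1]\cup\dots\cup[a_d,b_d]$ with real numbers $a_1<b_1<a_2<b_2<\dots<a_d<b_d$. The equilibrium measure of such a set is $\mathcal M_E=\frac1\pi|\eta|$ on $E$, that is, the measure on $E$ with density $$\frac1\pi\,\frac{|k(x)|}{\sqrt{\prod_{i=1}^d|x-a_i||x-b_i|}}$$ with respect to Lebesgue measure, where $k$ is the unique real monic polynomial of degree $d-1$ such that $$\int_{b_i}^{a_{i+1}}\frac{k(x)}{\sqrt{\prod_{l=1}^d|x-a_l||x-b_l|}}\,dx=0,\qquad i=1,\dots,d-1 .$$ (Here $\eta=k(z)\,dz/\mu$ is the differential of the third kind on $\mu^2=\prod_i(z-a_i)(z-b_i)$ with residues $\pm1$ at the two points at infinity and zero integrals over the gaps of $E$.) Let $\hat t=\frac12\min_{1\le i\le d-1}(a_{i+1}-b_i)$. For a vector of bribes $\mathbf t=(t_1,\dots,t_d)$ with $0\le t_j<\hat t$ for all $j$, put $$E(\mathbf t)=[a_1,b_1+t_1]\cup\dots\cup[a_d,b_d+t_d],\qquad h_j(\mathbf t)=\mathcal M_{E(\mathbf t)}\bigl([a_j,b_j+t_j]\bigr),\quad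 j=1,\dots,d .$$ Call $\mathbf t$ a fair solution if every share is the same as without bribes: $h_j(\mathbf t)=h_j(\mathbf 0)$ for all $j=1,\dots,d$. Suppose that at least one interval is fixed, i.e. $t_j=0$ for some $j\in\{1,\dots,d\}$. Then $\mathbf t$ is a fair solution if and only if $\mathbf t=\mathbf 0$. -/

import Mathlib

open MeasureTheory Polynomial

/-- `a` and `b` are the left and right endpoints of `d` nondegenerate, pairwise disjoint compact
intervals `[a j, b j]`, numbered from left to right. -/
def IsIntervalSystem {d : ℕ} (a b : Fin d → ℝ) : Prop :=
  (∀ j, a j < b j) ∧ ∀ i j, i < j → b i < a j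

/-- The polynomial `∏ (z - c)`, `c` running over all `2 d` endpoints, whose square root is `μ`. -/
noncomputable def endpointPoly {d : ℕ} (a b : Fin d → ℝ) : ℝ[X] :=
  ∏ j, ((X - C (a j)) * (X - C (b j)))

/-- `k` is the numerator of the differential of the third kind `η = k(z) dz / μ`: it has degree
`d - 1`, it is monic (so that the residues of `η` at the two points at infinity are `±1`), and `η`
has zero integral over each gap `(b i, a (i + 1))`. On a gap, `μ` is `√|∏ (z - c)|` up to
a constant factor. -/
def IsEtaNumerator {d : ℕ} (a b : Fin d → ℝ) (k : ℝ[X]) : Prop :=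
  k.Monic ∧ k.natDegree = d - 1 ∧
    ∀ i j : Fin d, (i : ℕ) + 1 = j →
      ∫ x in (b i)..(a j), k.eval x / √|(endpointPoly a b).eval x| = 0

/-- The numerator of `η`; it exists and is unique for every interval system, see
`existsUnique_etaNumerator`. -/
noncomputable def etaNumerator {d : ℕ} (a b : Fin d → ℝ) : ℝ[X] :=
  Classical.epsilon (IsEtaNumerator a b)

/-- The equilibrium measure `π⁻¹ |η|` on the union of the intervals `[a j, b j]`. -/
noncomputable def equilibriumMeasure {d : ℕ} (a b : Fin d → ℝ) : Measure ℝ :=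
  (volume.restrict (⋃ j, Set.Icc (a j) (b j))).withDensity fun x =>
    ENNReal.ofReal (Real.pi⁻¹ *
      (|(etaNumerator a b).eval x| / √|(endpointPoly a b).eval x|))

/-- The share `h j t` of the `j`-th sibling: the equilibrium measure of the extended set
`E(t) = ⋃ [a i, b i + t i]` evaluated at its `j`-th interval. -/
noncomputable def share {d : ℕ} (a b t : Fin d → ℝ) (j : Fin d) : ℝ :=
  (equilibriumMeasure a (b + t)).real (Set.Icc (a j) (b j + t j))

/-- Admissible bribes: nonnegative and smaller than half the length of the shortest gap. -/
def AdmissibleBribes {d : ℕ} (a b t : Fin d → ℝ) : Prop :=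
  ∀ l, 0 ≤ t l ∧ ∀ i j : Fin d, (i : ℕ) + 1 = j → t l < (a j - b i) / 2

/-- The bribes `t` are a fair solution: every share is what it is without bribes. -/
def IsFairSolution {d : ℕ} (a b t : Fin d → ℝ) : Prop :=
  ∀ j, share a b t j = share a b 0 j

theorem endpointPoly_ne_zero_of_gap {d : ℕ} {a b : Fin d → ℝ} (h : IsIntervalSystem a b)
    {i j : Fin d} (hij : (i : ℕ) + 1 = j) {x : ℝ} (hx : x ∈ Set.Ioo (b i) (a j)) :
    (endpointPoly a b).eval x ≠ 0 := by
  have hb : ∀ m n : Fin d, m ≤ n → b m ≤ b n := fun m n hmn => by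
    rcases hmn.eq_or_lt with rfl | hlt
    · exact le_rfl
    · exact ((h.2 m n hlt).trans (h.1 n)).le
  have ha : ∀ m n : Fin d, m ≤ n → a m ≤ a n := fun m n hmn => by
    rcases hmn.eq_or_lt with rfl | hlt
    · exact le_rfl
    · exact ((h.1 m).trans (h.2 m n hlt)).le
  rw [endpointPoly, eval_prod, Finset.prod_ne_zero_iff]
  intro l _
  simp only [eval_mul, eval_sub, eval_X, eval_C]
  have h1 := h.1 l
  rcases le_or_gt l i with hl | hl
  · have := hb l i hl
    have := hx.1
    exact mul_ne_zero (by linarith) (by linarith)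
  · have := ha j l (by rw [Fin.le_def]; rw [Fin.lt_def] at hl; omega)
    have := hx.2
    exact mul_ne_zero (by linarith) (by linarith)

theorem intervalIntegrable_inv_sqrt_abs_sub (c u v : ℝ) :
    IntervalIntegrable (fun x => (√|x - c|)⁻¹) volume u v := by
  have h1 : ∀ r : ℝ, 0 ≤ r → IntervalIntegrable (fun x : ℝ => (√|x|)⁻¹) volume 0 r := by
    intro r hr
    refine (intervalIntegral.intervalIntegrable_rpow' (a := 0) (b := r)
      (r := -(1 / 2)) (by norm_num)).congr fun x hx => ?_
    rw [Set.uIoc_of_le hr] at hx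
    rw [abs_of_pos hx.1, Real.sqrt_eq_rpow, Real.rpow_neg hx.1.le]
  have h2 : ∀ r : ℝ, IntervalIntegrable (fun x : ℝ => (√|x|)⁻¹) volume 0 r := by
    intro r
    rcases le_total 0 r with hr | hr
    · exact h1 r hr
    · have := (IntervalIntegrable.iff_comp_neg (f := fun x : ℝ => (√|x|)⁻¹)).1
        (h1 (-r) (by linarith))
      simpa using this
  have h3 := ((h2 (u - c)).symm.trans (h2 (v - c))).comp_sub_right c
  simpa using h3

theorem intervalIntegrable_inv_sqrt_gap {d : ℕ} {a b : Fin d → ℝ} (h : IsIntervalSystem a b)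
    {i j : Fin d} (hij : (i : ℕ) + 1 = j) :
    IntervalIntegrable (fun x => (√|(endpointPoly a b).eval x|)⁻¹) volume (b i) (a j) := by
  have hb : ∀ m n : Fin d, m < n → b m < b n := fun m n hlt => (h.2 m n hlt).trans (h.1 n)
  have ha : ∀ m n : Fin d, m < n → a m < a n := fun m n hlt => (h.1 m).trans (h.2 m n hlt)
  have hgap : b i < a j := h.2 i j (by rw [Fin.lt_def]; omega)
  have key : ∀ (c u v : ℝ) (Q : ℝ[X]), endpointPoly a b = (X - C c) * Q →
      (∀ x ∈ Set.uIcc u v, Q.eval x ≠ 0) →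
      IntervalIntegrable (fun x => (√|(endpointPoly a b).eval x|)⁻¹) volume u v := by
    intro c u v Q hQ hne
    have hc : ContinuousOn (fun x => (√|Q.eval x|)⁻¹) (Set.uIcc u v) := by
      refine ContinuousOn.inv₀ (by fun_prop) fun x hx => ?_
      exact (Real.sqrt_pos.2 (abs_pos.2 (hne x hx))).ne'
    refine ((intervalIntegrable_inv_sqrt_abs_sub c u v).mul_continuousOn hc).congr fun x _ => ?_
    simp only [hQ, eval_mul, eval_sub, eval_X, eval_C, abs_mul,
      Real.sqrt_mul (abs_nonneg (x - c)), mul_inv]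
  have hfac : ∀ l, endpointPoly a b = (X - C (a l)) * (X - C (b l)) *
      ∏ n ∈ Finset.univ.erase l, ((X - C (a n)) * (X - C (b n))) := fun l =>
    (Finset.mul_prod_erase _ _ (Finset.mem_univ l)).symm
  set m := (b i + a j) / 2 with hm
  refine IntervalIntegrable.trans (b := m) (key (b i) _ _ _ ((hfac i).trans
    (by rw [mul_comm (X - C (a i)), mul_assoc])) ?_)
    (key (a j) _ _ _ ((hfac j).trans (mul_assoc _ _ _)) ?_)
  · intro x hx
    rw [Set.uIcc_of_le (by linarith)] at hx
    rw [eval_mul, eval_prod]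
    refine mul_ne_zero ?_ (Finset.prod_ne_zero_iff.2 fun l hl => ?_)
    · have := h.1 i
      have := hx.1
      simp only [eval_sub, eval_X, eval_C]
      linarith
    · have h0 := h.1 l
      have h1 := hx.1
      have h2 := hx.2
      simp only [eval_mul, eval_sub, eval_X, eval_C]
      rcases lt_or_gt_of_ne (Finset.ne_of_mem_erase hl) with hl | hl
      · have := hb l i hl
        exact mul_ne_zero (by linarith) (by linarith)
      · have : a j ≤ a l := by
          rcases eq_or_lt_of_le (show j ≤ l by rw [Fin.le_def]; rw [Fin.lt_def] at hl; omega)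
            with rfl | hlt
          · exact le_rfl
          · exact (ha _ _ hlt).le
        exact mul_ne_zero (by linarith) (by linarith)
  · intro x hx
    rw [Set.uIcc_of_le (by linarith)] at hx
    rw [eval_mul, eval_prod]
    refine mul_ne_zero ?_ (Finset.prod_ne_zero_iff.2 fun l hl => ?_)
    · have := h.1 j
      have := hx.2
      simp only [eval_sub, eval_X, eval_C]
      linarith
    · have h0 := h.1 l
      have h1 := hx.1
      have h2 := hx.2
      simp only [eval_mul, eval_sub, eval_X, eval_C]
      rcases lt_or_gt_of_ne (Finset.ne_of_mem_erase hl) with hl | hl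
      · have : b l ≤ b i := by
          rcases eq_or_lt_of_le (show l ≤ i by rw [Fin.le_def]; rw [Fin.lt_def] at hl; omega)
            with rfl | hlt
          · exact le_rfl
          · exact (hb _ _ hlt).le
        exact mul_ne_zero (by linarith) (by linarith)
      · have := ha j l hl
        exact mul_ne_zero (by linarith) (by linarith)

theorem intervalIntegrable_eta_gap {d : ℕ} {a b : Fin d → ℝ} (h : IsIntervalSystem a b)
    {i j : Fin d} (hij : (i : ℕ) + 1 = j) (p : ℝ[X]) :
    IntervalIntegrable (fun x => p.eval x / √|(endpointPoly a b).eval x|) volume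
      (b i) (a j) := by
  simp only [div_eq_mul_inv]
  exact (intervalIntegrable_inv_sqrt_gap h hij).continuousOn_mul p.continuous.continuousOn

theorem exists_root_of_gap_integral {d : ℕ} {a b : Fin d → ℝ} (h : IsIntervalSystem a b)
    {i j : Fin d} (hij : (i : ℕ) + 1 = j) (p : ℝ[X])
    (hp : ∫ x in (b i)..(a j), p.eval x / √|(endpointPoly a b).eval x| = 0) :
    ∃ x ∈ Set.Ioo (b i) (a j), p.eval x = 0 := by
  have hgap : b i < a j := h.2 i j (by rw [Fin.lt_def]; omega)
  by_contra! hne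
  have hw : ∀ x ∈ Set.Ioo (b i) (a j), 0 < √|(endpointPoly a b).eval x| := fun x hx =>
    Real.sqrt_pos.2 (abs_pos.2 (endpointPoly_ne_zero_of_gap h hij hx))
  have hsign : (∀ x ∈ Set.Ioo (b i) (a j), 0 < p.eval x) ∨
      ∀ x ∈ Set.Ioo (b i) (a j), p.eval x < 0 := by
    by_contra! hcon
    obtain ⟨⟨x, hx, hx0⟩, y, hy, hy0⟩ := hcon
    obtain ⟨z, hz, hz0⟩ := isPreconnected_Ioo.intermediate_value hx hy
      p.continuous.continuousOn ⟨hx0, hy0⟩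
    exact hne z hz hz0
  rcases hsign with hs | hs
  · exact (intervalIntegral.intervalIntegral_pos_of_pos_on (intervalIntegrable_eta_gap h hij p)
      (fun x hx => div_pos (hs x hx) (hw x hx)) hgap).ne' hp
  · have := intervalIntegral.intervalIntegral_pos_of_pos_on
      (intervalIntegrable_eta_gap h hij p).neg
      (fun x hx => neg_pos.2 (div_neg_of_neg_of_pos (hs x hx) (hw x hx))) hgap
    have h2 : ∫ x in (b i)..(a j), -(p.eval x / √|(endpointPoly a b).eval x|) = 0 := by
      rw [intervalIntegral.integral_neg, hp, neg_zero]
    exact this.ne' h2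

theorem eq_zero_of_gap_integrals {d : ℕ} {a b : Fin d → ℝ} (h : IsIntervalSystem a b)
    (p : ℝ[X]) (hdeg : p.degree < ((d - 1 : ℕ) : WithBot ℕ))
    (hp : ∀ i j : Fin d, (i : ℕ) + 1 = j →
      ∫ x in (b i)..(a j), p.eval x / √|(endpointPoly a b).eval x| = 0) : p = 0 := by
  have hroot : ∀ n : Fin (d - 1), ∃ x ∈ Set.Ioo (b ⟨n, by omega⟩) (a ⟨n + 1, by omega⟩),
      p.eval x = 0 := fun n => exists_root_of_gap_integral h rfl p (hp _ _ rfl)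
  choose r hr hr0 using hroot
  have hmono : StrictMono r := by
    intro m n hmn
    rw [Fin.lt_def] at hmn
    refine (hr m).2.trans (lt_of_le_of_lt ?_ (hr n).1)
    rcases eq_or_lt_of_le (show (m : ℕ) + 1 ≤ n by omega) with he | hlt
    · have := h.1 ⟨n, by omega⟩
      simp only [he]
      exact this.le
    · exact ((h.1 _).trans ((h.2 _ _ (Fin.mk_lt_mk.2 hlt)).trans (h.1 _))).le
  refine eq_zero_of_degree_lt_of_eval_index_eq_zero (s := Finset.univ) hmono.injective.injOn
    (by simpa using hdeg) fun n _ => hr0 n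

/-- The numerator of `η` exists and is unique. -/
theorem existsUnique_etaNumerator {d : ℕ} {a b : Fin d → ℝ} (h : IsIntervalSystem a b) :
    ∃! k : ℝ[X], IsEtaNumerator a b k := by
  have hgap : ∀ (i j : Fin d) (hij : (i : ℕ) + 1 = j) (p q : ℝ[X]),
      ∫ x in (b i)..(a j), (p + q).eval x / √|(endpointPoly a b).eval x| =
      (∫ x in (b i)..(a j), p.eval x / √|(endpointPoly a b).eval x|) +
      ∫ x in (b i)..(a j), q.eval x / √|(endpointPoly a b).eval x| := by
    intro i j hij p q
    rw [← intervalIntegral.integral_add (intervalIntegrable_eta_gap h hij p)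
      (intervalIntegrable_eta_gap h hij q)]
    simp only [eval_add, add_div]
  let G : ℝ[X] →ₗ[ℝ] (Fin (d - 1) → ℝ) :=
    { toFun := fun p n => ∫ x in (b ⟨n, by omega⟩)..(a ⟨n + 1, by omega⟩),
        p.eval x / √|(endpointPoly a b).eval x|
      map_add' := fun p q => funext fun n => hgap _ _ rfl p q
      map_smul' := fun c p => funext fun n => by
        simp only [eval_smul, smul_eq_mul, mul_div_assoc, intervalIntegral.integral_const_mul,
          RingHom.id_apply, Pi.smul_apply] }
  let L : degreeLT ℝ (d - 1) →ₗ[ℝ] (Fin (d - 1) → ℝ) := G.domRestrict _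
  have hGz : ∀ p : ℝ[X], G p = 0 → ∀ i j : Fin d, (i : ℕ) + 1 = j →
      ∫ x in (b i)..(a j), p.eval x / √|(endpointPoly a b).eval x| = 0 := by
    intro p hp i j hij
    have := congrFun hp ⟨i, by omega⟩
    have hj : j = ⟨i + 1, by omega⟩ := Fin.ext hij.symm
    rw [hj]
    exact this
  have hinj : Function.Injective L := by
    rw [← LinearMap.ker_eq_bot, LinearMap.ker_eq_bot']
    intro p hp
    exact Subtype.ext (eq_zero_of_gap_integrals h p (mem_degreeLT.1 p.2) (hGz _ hp))
  have hfin : Module.finrank ℝ (degreeLT ℝ (d - 1)) = Module.finrank ℝ (Fin (d - 1) → ℝ) :=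
    (degreeLTEquiv ℝ (d - 1)).finrank_eq
  have : FiniteDimensional ℝ (degreeLT ℝ (d - 1)) :=
    (degreeLTEquiv ℝ (d - 1)).symm.finiteDimensional
  have hsurj : Function.Surjective L :=
    (LinearMap.injective_iff_surjective_of_finrank_eq_finrank hfin).1 hinj
  obtain ⟨q, hq⟩ := hsurj (-G (X ^ (d - 1)))
  have hqd : (q : ℝ[X]).degree < ((d - 1 : ℕ) : WithBot ℕ) := mem_degreeLT.1 q.2
  refine ⟨X ^ (d - 1) + (q : ℝ[X]), ⟨monic_X_pow_add (by simpa using hqd), ?_, hGz _ ?_⟩, ?_⟩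
  · rw [natDegree_eq_of_degree_eq (degree_add_eq_left_of_degree_lt (by simpa using hqd)),
      natDegree_X_pow]
  · have : G (q : ℝ[X]) = -G (X ^ (d - 1)) := hq
    rw [map_add, this, add_neg_cancel]
  · intro k hk
    have hk0 : IsEtaNumerator a b (X ^ (d - 1) + (q : ℝ[X])) := by
      refine ⟨monic_X_pow_add (by simpa using hqd), ?_, hGz _ ?_⟩
      · rw [natDegree_eq_of_degree_eq (degree_add_eq_left_of_degree_lt (by simpa using hqd)),
          natDegree_X_pow]
      · have : G (q : ℝ[X]) = -G (X ^ (d - 1)) := hq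
        rw [map_add, this, add_neg_cancel]
    set k₀ : ℝ[X] := X ^ (d - 1) + (q : ℝ[X])
    have hlt : (k - k₀).degree < ((d - 1 : ℕ) : WithBot ℕ) := by
      have h1 : k.degree = ((d - 1 : ℕ) : WithBot ℕ) := by
        rw [degree_eq_natDegree hk.1.ne_zero, hk.2.1]
      have h2 : k₀.degree = ((d - 1 : ℕ) : WithBot ℕ) := by
        rw [degree_eq_natDegree hk0.1.ne_zero, hk0.2.1]
      rw [← h1]
      exact degree_sub_lt_left (h1.trans h2.symm) hk.1.ne_zero
        (hk.1.leadingCoeff.trans hk0.1.leadingCoeff.symm)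
    refine sub_eq_zero.1 (eq_zero_of_gap_integrals h _ hlt fun i j hij => ?_)
    have := hgap i j hij (k - k₀) k₀
    rw [sub_add_cancel, hk.2.2 i j hij, hk0.2.2 i j hij] at this
    linarith

theorem isEtaNumerator_etaNumerator {d : ℕ} {a b : Fin d → ℝ} (h : IsIntervalSystem a b) :
    IsEtaNumerator a b (etaNumerator a b) :=
  Classical.epsilon_spec (existsUnique_etaNumerator h).exists

/-! Extending some intervals strictly lowers the mass of every interval that stays fixed, so a
nonzero bribe vector with t_j = 0 changes the share h_j. Extensions can be made one at a time. It
therefore suffices to move a single right endpoint b = b_m to β > b and to show that the equilibrium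
density drops at every interior point of every other interval (`density_lt_of_move`).

Let k, k' be the numerators and P, P' the endpoint polynomials before and after the move. Off [b, β]
the difference |k|/√|P| − |k'|/√|P'| has the sign of (x − b)Q(x), where Q = k²(x − β) − k'²(x − b)
has degree at most 2(d − 1). Each gap that does not start at b contains two zeros of Q, counted with
multiplicity: one because both differentials have zero integral there, one from a sign change of
k√|x − β| + k'√|x − b| (`exists_comparisonPoly_factor_of_gap`). If the moved interval is the last
one, this exhausts the degree, and Q(b) < 0 fixes the sign. Otherwise the shortened gap after β
supplies one more zero, and the sign is governed by a single affine factor px + q that is positive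
at b (`exists_affine_sign`).

If that factor were nonpositive somewhere inside another interval, the difference would have
opposite strict signs to the left and to the right of the convex hull of E. Cauchy's theorem
excludes this: k/μ − 1/(z + i) is holomorphic in the upper half plane and O(|z|⁻²), so its boundary
values have integral zero over ℝ. The real part of k/μ vanishes on the intervals and integrates to
zero over the gaps, so the real parts for the two systems differ by a function of total integral
zero outside the hull (`outer_integrals_eq_zero`). There Re(k/μ) is |k|/√|P| on the right and its
negative on the left, so opposite signs of the difference would give a nonzero total
(`not_outer_sign_change`). -/

/-! ### Cauchy's theorem for boundary values on the real line -/

open Filter Topology Asymptotics Complex in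
/-- If `f` is holomorphic in the upper half plane and decays like `‖z‖⁻²`, then its integral over
each horizontal line vanishes. -/
theorem integral_horizontal_line_eq_zero {f : ℂ → ℂ}
    (hf : DifferentiableOn ℂ f {z | 0 < z.im}) {C R₀ : ℝ} (hC : 0 ≤ C)
    (hdecay : ∀ z : ℂ, 0 < z.im → R₀ ≤ ‖z‖ → ‖f z‖ ≤ C / ‖z‖ ^ 2) {y : ℝ} (hy : 0 < y)
    (hint : Integrable fun x : ℝ => f (x + y * I)) : ∫ x : ℝ, f (x + y * I) = 0 := by
  have h1 : Tendsto (fun R : ℝ => ∫ x in (-R)..R, f (x + y * I)) atTop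
      (𝓝 (∫ x : ℝ, f (x + y * I))) :=
    intervalIntegral_tendsto_integral hint tendsto_neg_atTop_atBot tendsto_id
  refine tendsto_nhds_unique h1 ?_
  have h0 : Tendsto (fun R : ℝ => 4 * C * R⁻¹) atTop (𝓝 0) := by
    simpa using tendsto_inv_atTop_zero.const_mul (4 * C)
  refine squeeze_zero_norm' ?_ h0
  filter_upwards [eventually_ge_atTop R₀, eventually_ge_atTop y, eventually_gt_atTop 0]
    with R hR hRy hRpos
  -- The rectangle has corners −R + iy and R + iR. Its top and vertical sides have length O(R) and
  -- lie in |z| ≥ R, so each contributes O(1/R).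
  have hrect := integral_boundary_rect_eq_zero_of_differentiableOn f
    ((-R : ℝ) + y * I) ((R : ℝ) + R * I) (hf.mono fun z hz => by
      have := (mem_reProdIm.1 hz).2
      simp [Set.uIcc_of_le hRy] at this
      exact hy.trans_le this.1)
  simp only [add_re, ofReal_re, mul_re, I_re, mul_zero, ofReal_im, I_im, mul_one, sub_self,
    add_zero, add_im, mul_im, zero_add] at hrect
  have hb : ∀ z : ℂ, 0 < z.im → R ≤ ‖z‖ → ‖f z‖ ≤ C / R ^ 2 := fun z hz hzR =>
    (hdecay z hz (hR.trans hzR)).trans (by gcongr)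
  have top : ‖∫ x : ℝ in (-R)..R, f (x + R * I)‖ ≤ C / R ^ 2 * |R - -R| := by
    refine intervalIntegral.norm_integral_le_of_norm_le_const fun x _ => hb _ (by simpa) ?_
    have := abs_im_le_norm ((x : ℂ) + R * I)
    simp only [add_im, ofReal_im, mul_im, ofReal_re, I_im, mul_one, I_re, mul_zero, add_zero,
      zero_add, abs_of_pos hRpos] at this
    exact this
  have side : ∀ r : ℝ, |r| = R → ‖∫ v : ℝ in y..R, f (r + v * I)‖ ≤ C / R ^ 2 * |R - y| := by
    intro r hr
    refine intervalIntegral.norm_integral_le_of_norm_le_const fun v hv => hb _ ?_ ?_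
    · rw [Set.uIoc_of_le hRy] at hv
      simpa using hy.trans hv.1
    · have := abs_re_le_norm ((r : ℂ) + v * I)
      simpa [hr] using this
  have s1 := side R (abs_of_pos hRpos)
  have s2 := side (-R) (by rw [abs_neg, abs_of_pos hRpos])
  have e : ∫ x : ℝ in (-R)..R, f (x + y * I) = (∫ x : ℝ in (-R)..R, f (x + R * I)) -
      I * (∫ v : ℝ in y..R, f (R + v * I)) + I * ∫ v : ℝ in y..R, f ((-R : ℝ) + v * I) := by
    simp only [smul_eq_mul] at hrect
    linear_combination hrect
  rw [e]
  refine (norm_add_le_of_le (norm_sub_le_of_le top ((norm_mul _ _).trans_le ?_))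
    ((norm_mul _ _).trans_le ?_)).trans (b := C / R ^ 2 * |R - -R| + C / R ^ 2 * |R - y| +
      C / R ^ 2 * |R - y|) ?_
  · simpa using s1
  · simpa using s2
  · rw [abs_of_pos (by linarith), abs_of_nonneg (by linarith)]
    have : C / R ^ 2 * (R - -R) + C / R ^ 2 * (R - y) + C / R ^ 2 * (R - y) =
      4 * C * R⁻¹ - 2 * (C / R ^ 2) * y := by field_simp; ring
    rw [this]
    have : 0 ≤ 2 * (C / R ^ 2) * y := by positivity
    linarith

open Filter Topology Asymptotics Complex in
/-- The boundary values on the real line of a function that is holomorphic in the upper half plane,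
decays like `‖z‖⁻²`, and is dominated near the real line by a locally integrable function, are
integrable with integral `0`. -/
theorem integral_boundary_line_eq_zero {f : ℂ → ℂ}
    (hf : DifferentiableOn ℂ f {z | 0 < z.im}) {C R₀ : ℝ} (hR : 1 ≤ R₀)
    (hdecay : ∀ z : ℂ, 0 < z.im → R₀ ≤ ‖z‖ → ‖f z‖ ≤ C / ‖z‖ ^ 2)
    {g : ℝ → ℝ} (hg : LocallyIntegrable g)
    (hfg : ∀ᵐ x : ℝ, ∀ y : ℝ, |x| ≤ R₀ → 0 < y → y ≤ 1 → ‖f (x + y * I)‖ ≤ g x)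
    (hlim : ∀ᵐ x : ℝ, Tendsto (fun y : ℝ => f (x + y * I)) (𝓝[>] 0) (𝓝 (f x))) :
    Integrable (fun x : ℝ => f x) ∧ ∫ x : ℝ, f x = 0 := by
  have hC : 0 ≤ C := by
    have := (norm_nonneg _).trans (hdecay (R₀ * I) (by simp; linarith)
      (by simp [abs_of_nonneg (zero_le_one.trans hR)]))
    by_contra! hC
    refine absurd this (not_le.2 (div_neg_of_neg_of_pos hC ?_))
    have : (R₀ : ℂ) ≠ 0 := by exact_mod_cast (by linarith : R₀ ≠ 0)
    have : 0 < ‖(R₀ : ℂ) * I‖ := norm_pos_iff.2 (mul_ne_zero this I_ne_zero)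
    positivity
  -- A dominating function independent of the height y. For |x| > R₀ ≥ 1 one has C/|z|² ≤ C/x² ≤
  -- 2C/(1 + x²).
  set h : ℝ → ℝ := fun x => if |x| ≤ R₀ then g x else 2 * C * (1 + x ^ 2)⁻¹ with hh
  have hhint : Integrable h := by
    have hS : MeasurableSet {x : ℝ | |x| ≤ R₀} := measurableSet_le (by fun_prop) (by fun_prop)
    have e : h = Set.piecewise {x : ℝ | |x| ≤ R₀} g fun x => 2 * C * (1 + x ^ 2)⁻¹ := by
      ext x; simp [hh, Set.piecewise]
    rw [e]
    refine Integrable.piecewise hS ?_ (integrable_inv_one_add_sq.const_mul _).integrableOn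
    refine (hg.integrableOn_isCompact (isCompact_Icc (a := -R₀) (b := R₀))).mono_set ?_
    intro x hx
    exact abs_le.1 hx
  have hbound : ∀ᵐ x : ℝ, ∀ y : ℝ, 0 < y → y ≤ 1 → ‖f (x + y * I)‖ ≤ h x := by
    filter_upwards [hfg] with x hfgx y hy hy1
    by_cases hx : |x| ≤ R₀
    · simpa only [hh, hx, if_true] using hfgx y hx hy hy1
    · simp only [hh, hx, if_false]
      have hx' := not_le.1 hx
      have h1 : |x| ≤ ‖(x : ℂ) + y * I‖ := by
        simpa using abs_re_le_norm ((x : ℂ) + y * I)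
      refine (hdecay _ (by simpa) (hx'.le.trans h1)).trans ?_
      have hx1 : 1 ≤ x ^ 2 := by rw [← sq_abs]; nlinarith
      have h2 : (1 + x ^ 2) / 2 ≤ ‖(x : ℂ) + y * I‖ ^ 2 := by
        have : x ^ 2 ≤ ‖(x : ℂ) + y * I‖ ^ 2 := by rw [← sq_abs]; gcongr
        linarith
      calc C / ‖(x : ℂ) + y * I‖ ^ 2 ≤ C / ((1 + x ^ 2) / 2) := by gcongr
        _ = _ := by field_simp
  have hmeas : ∀ y : ℝ, 0 < y → Continuous fun x : ℝ => f (x + y * I) := by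
    intro y hy
    exact hf.continuousOn.comp_continuous (by fun_prop) (fun x => by simpa)
  have hev : ∀ᶠ y : ℝ in 𝓝[>] 0, 0 < y ∧ y ≤ 1 := by
    filter_upwards [Ioc_mem_nhdsGT (zero_lt_one (α := ℝ))] with y hy using hy
  have hzero : ∀ᶠ y : ℝ in 𝓝[>] 0, ∫ x : ℝ, f (x + y * I) = 0 := by
    filter_upwards [hev] with y hy
    refine integral_horizontal_line_eq_zero hf hC hdecay hy.1 ?_
    exact hhint.mono' (hmeas y hy.1).aestronglyMeasurable
      (hbound.mono fun x hx => hx y hy.1 hy.2)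
  have hfm : AEStronglyMeasurable (fun x : ℝ => f x) volume := by
    have hseq : Tendsto (fun n : ℕ => ((n : ℝ) + 1)⁻¹) atTop (𝓝[>] 0) :=
      tendsto_nhdsWithin_iff.2 ⟨by simpa using tendsto_one_div_add_atTop_nhds_zero_nat (𝕜 := ℝ),
        Eventually.of_forall fun n => by
          show (0 : ℝ) < ((n : ℝ) + 1)⁻¹
          positivity⟩
    refine aestronglyMeasurable_of_tendsto_ae atTop
      (f := fun (n : ℕ) (x : ℝ) => f (x + (((n : ℝ) + 1)⁻¹ : ℝ) * I))
      (fun n => (hmeas _ (by positivity)).aestronglyMeasurable) ?_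
    filter_upwards [hlim] with x hx using hx.comp hseq
  refine ⟨hhint.mono' hfm ?_, ?_⟩
  · filter_upwards [hlim, hbound] with x hx hbx
    refine le_of_tendsto hx.norm ?_
    filter_upwards [hev] with y hy using hbx y hy.1 hy.2
  · refine tendsto_nhds_unique (tendsto_integral_filter_of_dominated_convergence h
      (hev.mono fun y hy => (hmeas y hy.1).aestronglyMeasurable)
      (hev.mono fun y hy => hbound.mono fun x hx => hx y hy.1 hy.2) hhint hlim) ?_
    exact tendsto_const_nhds.congr' (hzero.mono fun y hy => hy.symm)

/-! ### The principal square root on the upper half plane -/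

/-- The principal branch of the square root. -/
noncomputable def csqrt (z : ℂ) : ℂ := Complex.exp (Complex.log z / 2)

theorem csqrt_ne_zero (z : ℂ) : csqrt z ≠ 0 := Complex.exp_ne_zero _

theorem csqrt_sq {z : ℂ} (hz : z ≠ 0) : csqrt z ^ 2 = z := by
  rw [csqrt, ← Complex.exp_nat_mul]
  push_cast
  rw [mul_div_cancel₀ _ two_ne_zero, Complex.exp_log hz]

theorem norm_csqrt {z : ℂ} (hz : z ≠ 0) : ‖csqrt z‖ = √‖z‖ := by
  rw [← Real.sqrt_sq (norm_nonneg (csqrt z)), ← norm_pow, csqrt_sq hz]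

theorem csqrt_ofReal_of_pos {x : ℝ} (hx : 0 < x) : csqrt x = √x := by
  rw [csqrt, ← Complex.ofReal_log hx.le, Real.sqrt_eq_rpow, Real.rpow_def_of_pos hx]
  push_cast
  ring_nf

theorem csqrt_ofReal_of_neg {x : ℝ} (hx : x < 0) : csqrt x = Complex.I * √(-x) := by
  have h1 : Complex.log (x : ℂ) = Complex.log ((-x : ℝ) : ℂ) + Real.pi * Complex.I := by
    rw [Complex.log, Complex.log, Complex.arg_ofReal_of_neg hx,
      Complex.arg_ofReal_of_nonneg (by linarith)]
    simp
  rw [csqrt, h1, add_div, Complex.exp_add, ← csqrt, csqrt_ofReal_of_pos (by linarith), mul_comm,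
    mul_div_right_comm, Complex.exp_pi_div_two_mul_I]

theorem re_csqrt_nonneg (z : ℂ) : 0 ≤ (csqrt z).re := by
  rw [csqrt, Complex.exp_re]
  refine mul_nonneg (Real.exp_pos _).le (Real.cos_nonneg_of_mem_Icc ?_)
  have h1 := Complex.neg_pi_lt_arg z
  have h2 := Complex.arg_le_pi z
  simp only [Complex.div_ofNat_im, Complex.log_im, Set.mem_Icc]
  constructor <;> linarith

theorem im_csqrt_nonneg {z : ℂ} (hz : 0 ≤ z.im) : 0 ≤ (csqrt z).im := by
  rw [csqrt, Complex.exp_im]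
  refine mul_nonneg (Real.exp_pos _).le (Real.sin_nonneg_of_mem_Icc ?_)
  have h1 := Complex.arg_nonneg_iff.2 hz
  have h2 := Complex.arg_le_pi z
  simp only [Complex.div_ofNat_im, Complex.log_im, Set.mem_Icc]
  constructor <;> linarith

/-- Two vectors of the closed first quadrant have nonnegative inner product. This prevents
cancellation in √z + √(z − c). -/
theorem norm_le_norm_add_of_quadrant {u v : ℂ} (h1 : 0 ≤ u.re) (h2 : 0 ≤ u.im) (h3 : 0 ≤ v.re)
    (h4 : 0 ≤ v.im) : ‖v‖ ≤ ‖u + v‖ := by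
  rw [← sq_le_sq₀ (norm_nonneg _) (norm_nonneg _), Complex.sq_norm, Complex.sq_norm,
    Complex.normSq_apply, Complex.normSq_apply, Complex.add_re, Complex.add_im]
  nlinarith [mul_nonneg h1 h3, mul_nonneg h2 h4, mul_self_nonneg u.re, mul_self_nonneg u.im]

/-- Rationalise: √z − √(z − c) = c/(√z + √(z − c)), and the denominator is at least |√(z − c)|
because both roots lie in the first quadrant. -/
theorem norm_csqrt_div_csqrt_sub_one_le {z : ℂ} (hz : 0 < z.im) (c : ℝ) :
    ‖csqrt z / csqrt (z - c) - 1‖ ≤ |c| / ‖z - c‖ := by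
  have hc : 0 < (z - c).im := by simpa
  have hz0 : z ≠ 0 := fun h => by simp [h] at hz
  have hc0 : z - c ≠ 0 := fun h => by simp [h] at hc
  have hle := norm_le_norm_add_of_quadrant (re_csqrt_nonneg z) (im_csqrt_nonneg hz.le)
    (re_csqrt_nonneg (z - c)) (im_csqrt_nonneg hc.le)
  have hpos : 0 < ‖csqrt (z - c)‖ := norm_pos_iff.2 (csqrt_ne_zero _)
  have hsum : csqrt z + csqrt (z - c) ≠ 0 := norm_pos_iff.1 (hpos.trans_le hle)
  have e : csqrt z / csqrt (z - c) - 1 = c / ((csqrt z + csqrt (z - c)) * csqrt (z - c)) := by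
    have h1 := csqrt_sq hz0
    have h2 := csqrt_sq hc0
    have h3 := csqrt_ne_zero (z - c)
    rw [div_sub_one h3, div_eq_div_iff h3 (mul_ne_zero hsum h3)]
    linear_combination csqrt (z - c) * (h1 - h2)
  rw [e, norm_div, norm_mul, Complex.norm_real, Real.norm_eq_abs]
  have h4 : ‖z - c‖ = ‖csqrt (z - c)‖ * ‖csqrt (z - c)‖ := by
    rw [← norm_mul, ← sq, csqrt_sq hc0]
  rw [h4]
  gcongr

theorem differentiableAt_csqrt {z : ℂ} (hz : 0 < z.im) : DifferentiableAt ℂ csqrt z := by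
  have : z ∈ Complex.slitPlane := Or.inr hz.ne'
  unfold csqrt
  fun_prop (disch := assumption)

open Filter Topology in
-- At negative reals the logarithm is continuous from above only, so the approach has to stay in the
-- closed upper half plane.
theorem tendsto_csqrt_boundary {x : ℝ} (hx : x ≠ 0) :
    Tendsto (fun y : ℝ => csqrt (x + y * Complex.I)) (𝓝[>] 0) (𝓝 (csqrt x)) := by
  have hlog : ContinuousWithinAt Complex.log {z : ℂ | 0 ≤ z.im} (x : ℂ) := by
    rcases hx.lt_or_gt with h | h
    · exact Complex.continuousWithinAt_log_of_re_neg_of_im_zero (by simpa) (by simp)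
    · exact (continuousAt_clog (Or.inl (by simpa))).continuousWithinAt
  have h1 : Tendsto (fun y : ℝ => (x : ℂ) + y * Complex.I) (𝓝[>] 0)
      (𝓝[{z : ℂ | 0 ≤ z.im}] (x : ℂ)) := by
    refine tendsto_nhdsWithin_iff.2 ⟨?_, ?_⟩
    · refine (Continuous.tendsto' (by fun_prop) _ _ (by simp)).mono_left nhdsWithin_le_nhds
    · filter_upwards [self_mem_nhdsWithin] with y hy
      simpa using (le_of_lt hy : (0 : ℝ) ≤ y)
  exact ((Complex.continuous_exp.tendsto _).comp ((hlog.tendsto.comp h1).div_const 2))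

/-! ### The branch of the differential and its behaviour at infinity -/

/-- The branch `k(z) / μ(z)` of the differential in the closed upper half plane. -/
noncomputable def etaBranch {d : ℕ} (a b : Fin d → ℝ) (k : ℝ[X]) (z : ℂ) : ℂ :=
  aeval z k / ∏ j, (csqrt (z - a j) * csqrt (z - b j))

open Filter Topology Asymptotics in
-- Use fg − 1 = f(g − 1) + (f − 1) with f bounded.
theorem isBigO_mul_sub_one {l : Filter ℂ} {f g e : ℂ → ℂ} (he : Tendsto e l (𝓝 0))
    (hf : (fun z => f z - 1) =O[l] e) (hg : (fun z => g z - 1) =O[l] e) :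
    (fun z => f z * g z - 1) =O[l] e := by
  have h1 : Tendsto (fun z => f z - 1) l (𝓝 0) := hf.trans_tendsto he
  have h2 : f =O[l] (fun _ => (1 : ℂ)) := by
    have : Tendsto f l (𝓝 1) := by simpa using h1.add_const 1
    exact this.isBigO_one ℂ
  have h3 : (fun z => f z * (g z - 1)) =O[l] e := by simpa using h2.mul hg
  exact (h3.add hf).congr_left fun z => by ring

open Filter Topology Asymptotics in
theorem isBigO_prod_sub_one {ι : Type*} {l : Filter ℂ} {f : ι → ℂ → ℂ} {e : ℂ → ℂ}
    (he : Tendsto e l (𝓝 0)) (s : Finset ι) (hf : ∀ i ∈ s, (fun z => f i z - 1) =O[l] e) :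
    (fun z => (∏ i ∈ s, f i z) - 1) =O[l] e := by
  classical
  induction s using Finset.induction_on with
  | empty => simpa using isBigO_zero e l
  | insert i s hi ih =>
    simp only [Finset.prod_insert hi]
    exact isBigO_mul_sub_one he (hf i (Finset.mem_insert_self _ _))
      (ih fun j hj => hf j (Finset.mem_insert_of_mem hj))

/-- The filter of neighbourhoods of infinity in the upper half plane. -/
noncomputable def upperInfinity : Filter ℂ := Bornology.cobounded ℂ ⊓ Filter.principal {z | 0 < z.im}

open Filter Topology Asymptotics

theorem tendsto_inv_upperInfinity : Tendsto (fun z : ℂ => z⁻¹) upperInfinity (𝓝 0) :=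
  tendsto_inv₀_cobounded.mono_left inf_le_left

theorem eventually_upperInfinity_im_pos : ∀ᶠ z in upperInfinity, 0 < z.im :=
  mem_inf_of_right (mem_principal_self _)

theorem isBigO_inv_sub_upperInfinity (c : ℂ) :
    (fun z : ℂ => (z - c)⁻¹) =O[upperInfinity] fun z => z⁻¹ := by
  have h : ∀ᶠ z : ℂ in upperInfinity, 2 * ‖c‖ + 1 ≤ ‖z‖ :=
    (tendsto_norm_cobounded_atTop.eventually_ge_atTop _).filter_mono inf_le_left
  refine IsBigO.of_bound 2 ?_
  filter_upwards [h] with z hz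
  have h1 : ‖z‖ - ‖c‖ ≤ ‖z - c‖ := norm_sub_norm_le _ _
  have h2 := norm_nonneg c
  rw [norm_inv, norm_inv, ← div_eq_mul_inv, inv_eq_one_div, div_le_div_iff₀ (by linarith)
    (by linarith)]
  linarith

theorem isBigO_csqrt_ratio_sub_one (c : ℝ) :
    (fun z : ℂ => csqrt z / csqrt (z - c) - 1) =O[upperInfinity] fun z => z⁻¹ := by
  refine IsBigO.trans (IsBigO.of_bound |c| ?_) (isBigO_inv_sub_upperInfinity c)
  filter_upwards [eventually_upperInfinity_im_pos] with z hz
  rw [norm_inv, ← div_eq_mul_inv]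
  exact norm_csqrt_div_csqrt_sub_one_le hz c

theorem isBigO_monic_div_pow_sub_one {k : ℝ[X]} {n : ℕ} (hk : k.Monic) (hn : k.natDegree = n) :
    (fun z : ℂ => aeval z k / z ^ n - 1) =O[upperInfinity] fun z => z⁻¹ := by
  have hz0 : ∀ᶠ z : ℂ in upperInfinity, z ≠ 0 :=
    eventually_upperInfinity_im_pos.mono fun z hz h => by simp [h] at hz
  have key : ∀ i ∈ Finset.range n, (fun z : ℂ => (k.coeff i : ℂ) * (z ^ i / z ^ n))
      =O[upperInfinity] fun z => z⁻¹ := by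
    intro i hi
    refine IsBigO.const_mul_left ?_ _
    have hin : i < n := Finset.mem_range.1 hi
    have : (fun z : ℂ => z⁻¹ ^ (n - i)) =O[upperInfinity] fun z => z⁻¹ := by
      obtain ⟨m, hm⟩ : ∃ m, n - i = m + 1 := ⟨n - i - 1, by omega⟩
      simp only [hm, pow_succ]
      simpa using ((tendsto_inv_upperInfinity.isBigO_one ℂ).pow m).mul
        (isBigO_refl (fun z : ℂ => z⁻¹) upperInfinity)
    refine this.congr' ?_ EventuallyEq.rfl
    filter_upwards [hz0] with z hz
    rw [inv_pow, inv_eq_iff_eq_inv, inv_div, pow_sub₀ _ hz hin.le, div_eq_mul_inv]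
  have hsum : (fun z : ℂ => ∑ i ∈ Finset.range n, (k.coeff i : ℂ) * (z ^ i / z ^ n))
      =O[upperInfinity] fun z => z⁻¹ := IsBigO.fun_sum key
  refine hsum.congr' ?_ EventuallyEq.rfl
  filter_upwards [hz0] with z hz
  rw [aeval_eq_sum_range, hn, Finset.sum_range_succ, ← hn, hk.coeff_natDegree, hn, add_div, one_smul,
    div_self (pow_ne_zero _ hz), add_sub_cancel_right, Finset.sum_div]
  refine Finset.sum_congr rfl fun i _ => ?_
  rw [Algebra.smul_def, mul_div_assoc]
  rfl

/-- k/μ is 1/z times finitely many factors 1 + O(1/z); monicity of k gives the leading coefficient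
1. The term 1/z is replaced by 1/(z + i), whose pole lies below the real line, so that subtracting
it creates no singularity on the closed upper half plane. -/
theorem isBigO_etaBranch_sub {d : ℕ} (hd : 1 ≤ d) (a b : Fin d → ℝ) {k : ℝ[X]} (hk : k.Monic)
    (hn : k.natDegree = d - 1) :
    (fun z : ℂ => etaBranch a b k z - (z + Complex.I)⁻¹) =O[upperInfinity] fun z => z⁻¹ ^ 2 := by
  have hz0 : ∀ᶠ z : ℂ in upperInfinity, z ≠ 0 :=
    eventually_upperInfinity_im_pos.mono fun z hz h => by simp [h] at hz
  have h1 : (fun z : ℂ => aeval z k / z ^ (d - 1) *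
      ∏ j, (csqrt z / csqrt (z - a j) * (csqrt z / csqrt (z - b j))) - 1)
      =O[upperInfinity] fun z => z⁻¹ :=
    isBigO_mul_sub_one tendsto_inv_upperInfinity (isBigO_monic_div_pow_sub_one hk hn)
      (isBigO_prod_sub_one tendsto_inv_upperInfinity _ fun j _ =>
        isBigO_mul_sub_one tendsto_inv_upperInfinity (isBigO_csqrt_ratio_sub_one _)
          (isBigO_csqrt_ratio_sub_one _))
  have h2 : (fun z : ℂ => Complex.I * (z - -Complex.I)⁻¹) =O[upperInfinity] fun z => z⁻¹ :=
    (isBigO_inv_sub_upperInfinity _).const_mul_left _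
  have h3 := (isBigO_refl (fun z : ℂ => z⁻¹) upperInfinity).mul (h1.add h2)
  refine h3.congr' ?_ (Eventually.of_forall fun z => (sq _).symm)
  filter_upwards [hz0, eventually_upperInfinity_im_pos] with z hz hzi
  have hzI : z + Complex.I ≠ 0 := fun h => by
    have := congrArg Complex.im h
    simp at this
    linarith
  have hprod : ∏ j, (csqrt z / csqrt (z - a j) * (csqrt z / csqrt (z - b j))) =
      z ^ d / ∏ j, (csqrt (z - a j) * csqrt (z - b j)) := by
    have : ∀ j, csqrt z / csqrt (z - a j) * (csqrt z / csqrt (z - b j)) =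
        z / (csqrt (z - a j) * csqrt (z - b j)) := fun j => by
      rw [div_mul_div_comm, ← sq, csqrt_sq hz]
    simp only [this, Finset.prod_div_distrib, Finset.prod_const, Finset.card_univ,
      Fintype.card_fin]
  have hpow : z ^ d = z ^ (d - 1) * z := by rw [← pow_succ, Nat.sub_add_cancel hd]
  have hW : ∏ j, (csqrt (z - a j) * csqrt (z - b j)) ≠ 0 :=
    Finset.prod_ne_zero_iff.2 fun j _ => mul_ne_zero (csqrt_ne_zero _) (csqrt_ne_zero _)
  rw [hprod, hpow, etaBranch, sub_neg_eq_add]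
  have := pow_ne_zero (d - 1) hz
  field_simp
  ring

/-! ### Order of the endpoints and integrability of 1/√|P| -/

theorem IsIntervalSystem.left_strictMono {d : ℕ} {a b : Fin d → ℝ} (h : IsIntervalSystem a b) :
    StrictMono a := fun i j hij => (h.1 i).trans (h.2 i j hij)

theorem IsIntervalSystem.right_strictMono {d : ℕ} {a b : Fin d → ℝ} (h : IsIntervalSystem a b) :
    StrictMono b := fun i j hij => (h.2 i j hij).trans (h.1 j)

theorem IsIntervalSystem.left_ne_right {d : ℕ} {a b : Fin d → ℝ} (h : IsIntervalSystem a b)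
    (i j : Fin d) : a i ≠ b j := by
  rcases le_or_gt i j with hij | hij
  · exact ((h.left_strictMono.monotone hij).trans_lt (h.1 j)).ne
  · exact (h.2 j i hij).ne'

theorem eval_endpointPoly {d : ℕ} (a b : Fin d → ℝ) (x : ℝ) :
    (endpointPoly a b).eval x = ∏ j, ((x - a j) * (x - b j)) := by
  simp [endpointPoly, eval_prod]

theorem eval_endpointPoly_ne_zero_iff {d : ℕ} {a b : Fin d → ℝ} {x : ℝ} :
    (endpointPoly a b).eval x ≠ 0 ↔ ∀ j, x ≠ a j ∧ x ≠ b j := by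
  simp [eval_endpointPoly, Finset.prod_ne_zero_iff, sub_eq_zero]

theorem endpointPoly_ne_zero {d : ℕ} (a b : Fin d → ℝ) : endpointPoly a b ≠ 0 :=
  Finset.prod_ne_zero_iff.2 fun _ _ => mul_ne_zero (X_sub_C_ne_zero _) (X_sub_C_ne_zero _)

theorem ae_eval_endpointPoly_ne_zero {d : ℕ} (a b : Fin d → ℝ) :
    ∀ᵐ x : ℝ, (endpointPoly a b).eval x ≠ 0 := by
  have : {x : ℝ | (endpointPoly a b).IsRoot x}.Finite :=
    Polynomial.finite_setOfPred_isRoot (endpointPoly_ne_zero a b)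
  simpa using this.countable.ae_notMem volume

theorem endpointPoly_separable {d : ℕ} {a b : Fin d → ℝ} (h : IsIntervalSystem a b) :
    (endpointPoly a b).Separable := by
  have e : endpointPoly a b = ∏ s : Fin d ⊕ Fin d, (X - C (Sum.elim a b s)) := by
    rw [Fintype.prod_sum_type, endpointPoly, Finset.prod_mul_distrib]
    rfl
  rw [e, separable_prod_X_sub_C_iff]
  exact h.left_strictMono.injective.sumElim h.right_strictMono.injective h.left_ne_right

/-- The endpoints are simple zeros, so near each of them the function is |x − x₀|^(−1/2) times a
continuous factor. -/
theorem locallyIntegrable_inv_sqrt_endpointPoly {d : ℕ} {a b : Fin d → ℝ}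
    (h : IsIntervalSystem a b) :
    LocallyIntegrable fun x => (√|(endpointPoly a b).eval x|)⁻¹ := by
  intro x₀
  obtain ⟨f, Q, hf, hQ, hfQ⟩ : ∃ (f : ℝ → ℝ) (Q : ℝ[X]), LocallyIntegrable f ∧ Q.eval x₀ ≠ 0 ∧
      ∀ x, (√|(endpointPoly a b).eval x|)⁻¹ = f x * (√|Q.eval x|)⁻¹ := by
    by_cases h0 : (endpointPoly a b).eval x₀ = 0
    · obtain ⟨Q, hQ⟩ := dvd_iff_isRoot.2 h0
      refine ⟨fun x => (√|x - x₀|)⁻¹, Q, ?_, ?_, fun x => ?_⟩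
      · intro x
        refine ⟨Set.Ioc (x - 1) (x + 1), Ioc_mem_nhds (by linarith) (by linarith), ?_⟩
        exact (intervalIntegrable_iff_integrableOn_Ioc_of_le (by linarith)).1
          (intervalIntegrable_inv_sqrt_abs_sub x₀ (x - 1) (x + 1))
      -- With P = (X − x₀)Q one has P'(x₀) = Q(x₀), which separability makes nonzero.
      · have := (endpointPoly_separable h).eval₂_derivative_ne_zero (RingHom.id ℝ) (x := x₀) h0
        rw [hQ] at this
        simpa [eval₂_id, derivative_mul] using this
      · simp only [hQ, eval_mul, eval_sub, eval_X, eval_C, abs_mul,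
          Real.sqrt_mul (abs_nonneg (x - x₀)), mul_inv]
    · exact ⟨fun _ => 1, _, continuous_const.locallyIntegrable, h0, fun x => (one_mul _).symm⟩
  have hcont : ContinuousAt (fun x => (√|Q.eval x|)⁻¹) x₀ := by
    refine ContinuousAt.inv₀ (by fun_prop) (Real.sqrt_pos.2 (abs_pos.2 hQ)).ne'
  obtain ⟨s, hs, hfs⟩ := hf x₀
  have hev := hcont.norm.eventually_lt_const (lt_add_one _)
  refine ⟨_, inter_mem hs hev, ?_⟩
  have hm : Measurable fun x => (√|(endpointPoly a b).eval x|)⁻¹ := by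
    have := (endpointPoly a b).continuous
    fun_prop
  have hm2 : MeasurableSet {x | ‖(√|Q.eval x|)⁻¹‖ < ‖(√|Q.eval x₀|)⁻¹‖ + 1} := by
    have := Q.continuous
    exact measurableSet_lt (by fun_prop) (by fun_prop)
  refine Integrable.mono' ((hfs.mono_set Set.inter_subset_left).norm.const_mul
    (‖(√|Q.eval x₀|)⁻¹‖ + 1)) hm.aestronglyMeasurable ?_
  refine ae_restrict_of_ae_restrict_of_subset Set.inter_subset_right ?_
  filter_upwards [ae_restrict_mem hm2] with x hx
  rw [hfQ, norm_mul, mul_comm]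
  exact mul_le_mul_of_nonneg_right hx.le (norm_nonneg _)

/-! ### Boundary values of the branch and their vanishing integral -/

/-- Since |x + iy − c| ≥ |x − c|, the denominator is smallest on the real line. This yields a
locally integrable bound uniform in the height, as dominated convergence requires. -/
theorem norm_etaBranch_le {d : ℕ} (a b : Fin d → ℝ) (k : ℝ[X]) {x y : ℝ} (hy : 0 < y)
    (hx : (endpointPoly a b).eval x ≠ 0) :
    ‖etaBranch a b k (x + y * Complex.I)‖ ≤
      ‖aeval ((x : ℂ) + y * Complex.I) k‖ * (√|(endpointPoly a b).eval x|)⁻¹ := by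
  have h1 : ∀ c : ℝ, √|x - c| ≤ ‖csqrt ((x : ℂ) + y * Complex.I - c)‖ := by
    intro c
    have hne : (x : ℂ) + y * Complex.I - c ≠ 0 := fun h => by
      have := congrArg Complex.im h
      simp at this
      exact hy.ne' this
    rw [norm_csqrt hne]
    refine Real.sqrt_le_sqrt ?_
    simpa using Complex.abs_re_le_norm ((x : ℂ) + y * Complex.I - c)
  rw [etaBranch, norm_div, div_eq_mul_inv, norm_prod]
  refine mul_le_mul_of_nonneg_left (inv_anti₀ (Real.sqrt_pos.2 (abs_pos.2 hx)) ?_) (norm_nonneg _)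
  rw [eval_endpointPoly, Finset.abs_prod, Real.sqrt_prod _ fun _ _ => abs_nonneg _]
  refine Finset.prod_le_prod (fun _ _ => Real.sqrt_nonneg _) fun j _ => ?_
  rw [abs_mul, Real.sqrt_mul (abs_nonneg _), norm_mul]
  exact mul_le_mul (h1 _) (h1 _) (Real.sqrt_nonneg _) (norm_nonneg _)

theorem tendsto_etaBranch_boundary {d : ℕ} (a b : Fin d → ℝ) (k : ℝ[X]) {x : ℝ}
    (hx : (endpointPoly a b).eval x ≠ 0) :
    Tendsto (fun y : ℝ => etaBranch a b k (x + y * Complex.I)) (𝓝[>] 0)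
      (𝓝 (etaBranch a b k x)) := by
  rw [eval_endpointPoly_ne_zero_iff] at hx
  have h1 : ∀ c : ℝ, x ≠ c → Tendsto (fun y : ℝ => csqrt ((x : ℂ) + y * Complex.I - c)) (𝓝[>] 0)
      (𝓝 (csqrt (x - c))) := by
    intro c hc
    have := tendsto_csqrt_boundary (sub_ne_zero.2 hc)
    push_cast at this
    exact this.congr fun y => by ring_nf
  have h2 : Tendsto (fun y : ℝ => aeval ((x : ℂ) + y * Complex.I) k) (𝓝[>] 0)
      (𝓝 (aeval (x : ℂ) k)) := by
    have : Continuous fun y : ℝ => aeval ((x : ℂ) + y * Complex.I) k :=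
      k.continuous_aeval.comp (by fun_prop)
    exact (this.tendsto' _ _ (by simp)).mono_left nhdsWithin_le_nhds
  refine h2.div (tendsto_finsetProd _ fun j _ => (h1 _ (hx j).1).mul (h1 _ (hx j).2)) ?_
  exact Finset.prod_ne_zero_iff.2 fun j _ => mul_ne_zero (csqrt_ne_zero _) (csqrt_ne_zero _)

theorem differentiableOn_etaBranch {d : ℕ} (a b : Fin d → ℝ) (k : ℝ[X]) :
    DifferentiableOn ℂ (etaBranch a b k) {z | 0 < z.im} := by
  intro z hz
  have h1 : ∀ c : ℝ, DifferentiableAt ℂ (fun z : ℂ => csqrt (z - c)) z := fun c =>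
    DifferentiableAt.comp z (g := csqrt) (differentiableAt_csqrt (by simpa using hz)) (by fun_prop)
  refine (DifferentiableAt.div k.differentiable_aeval.differentiableAt
    (DifferentiableAt.fun_finsetProd fun j _ => (h1 _).mul (h1 _)) ?_).differentiableWithinAt
  exact Finset.prod_ne_zero_iff.2 fun j _ => mul_ne_zero (csqrt_ne_zero _) (csqrt_ne_zero _)

theorem integral_etaBranch_sub_eq_zero {d : ℕ} (hd : 1 ≤ d) {a b : Fin d → ℝ}
    (h : IsIntervalSystem a b) {k : ℝ[X]} (hk : k.Monic) (hn : k.natDegree = d - 1) :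
    Integrable (fun x : ℝ => etaBranch a b k x - ((x : ℂ) + Complex.I)⁻¹) ∧
      ∫ x : ℝ, (etaBranch a b k x - ((x : ℂ) + Complex.I)⁻¹) = 0 := by
  have hI : ∀ z : ℂ, 0 ≤ z.im → z + Complex.I ≠ 0 := fun z hz h0 => by
    have := congrArg Complex.im h0
    simp at this
    linarith
  obtain ⟨C, hC⟩ := (isBigO_etaBranch_sub hd a b hk hn).bound
  rw [upperInfinity, eventually_inf_principal, ← comap_norm_atTop, eventually_comap] at hC
  obtain ⟨R, hR⟩ := eventually_atTop.1 hC
  -- K bounds k on the box below which decay at infinity is not available. The summand 1 in the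
  -- dominating function covers |x + iy + i|⁻¹ ≤ 1.
  obtain ⟨K, hK⟩ := ((isCompact_Icc (a := -max R 1) (b := max R 1)).prod
    (isCompact_Icc (a := (0 : ℝ)) (b := 1))).exists_bound_of_continuousOn
    (f := fun p : ℝ × ℝ => aeval ((p.1 : ℂ) + p.2 * Complex.I) k)
    (k.continuous_aeval.comp (by fun_prop)).continuousOn
  refine integral_boundary_line_eq_zero (f := fun z => etaBranch a b k z - (z + Complex.I)⁻¹)
    (R₀ := max R 1) (C := C) (g := fun x => K * (√|(endpointPoly a b).eval x|)⁻¹ + 1)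
    ?_ (le_max_right _ _) ?_ ?_ ?_ ?_
  · refine (differentiableOn_etaBranch a b k).sub fun z hz => ?_
    have : DifferentiableAt ℂ (fun z : ℂ => z + Complex.I) z := by fun_prop
    exact (this.inv (hI z (le_of_lt hz))).differentiableWithinAt
  · intro z hz hzR
    refine (hR _ ((le_max_left _ _).trans hzR) z rfl hz).trans_eq ?_
    rw [norm_pow, norm_inv, inv_pow, div_eq_mul_inv]
  · exact ((locallyIntegrable_inv_sqrt_endpointPoly h).smul K).add
      continuous_const.locallyIntegrable
  · filter_upwards [ae_eval_endpointPoly_ne_zero a b] with x hx y hxR hy hy1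
    refine (norm_sub_le _ _).trans (add_le_add ((norm_etaBranch_le a b k hy hx).trans ?_) ?_)
    · gcongr
      exact hK (x, y) ⟨abs_le.1 hxR, hy.le, hy1⟩
    · rw [norm_inv]
      refine inv_le_one_of_one_le₀ ?_
      have := (Complex.abs_im_le_norm ((x : ℂ) + y * Complex.I + Complex.I))
      simp [abs_of_pos (by linarith : 0 < y + 1)] at this
      linarith
  · filter_upwards [ae_eval_endpointPoly_ne_zero a b] with x hx
    refine (tendsto_etaBranch_boundary a b k hx).sub (Tendsto.inv₀ ?_ (hI x (by simp)))
    have : Continuous fun y : ℝ => (x : ℂ) + y * Complex.I + Complex.I := by fun_prop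
    exact (this.tendsto' _ _ (by simp)).mono_left nhdsWithin_le_nhds

/-! ### The real part of the branch on intervals, on gaps and outside the hull -/

theorem csqrt_mul_csqrt_of_notMem_Icc {a b x : ℝ} (hab : a < b) (hx : x ∉ Set.Icc a b) :
    csqrt (x - a) * csqrt (x - b) =
      (((if a < x then 1 else -1) * (√|x - a| * √|x - b|) : ℝ) : ℂ) := by
  simp only [← Complex.ofReal_sub]
  rcases lt_or_ge x a with h | h
  · rw [csqrt_ofReal_of_neg (by linarith), csqrt_ofReal_of_neg (by linarith),
      abs_of_neg (by linarith), abs_of_neg (by linarith), if_neg h.not_gt]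
    push_cast
    linear_combination (√(-(x - a)) : ℂ) * √(-(x - b)) * Complex.I_mul_I
  · have hb : b < x := by
      by_contra! hb
      exact hx ⟨h, hb⟩
    rw [csqrt_ofReal_of_pos (by linarith), csqrt_ofReal_of_pos (by linarith),
      abs_of_pos (by linarith), abs_of_pos (by linarith), if_pos (by linarith)]
    push_cast
    ring

theorem csqrt_mul_csqrt_of_mem_Ioo {a b x : ℝ} (hx : x ∈ Set.Ioo a b) :
    csqrt (x - a) * csqrt (x - b) = Complex.I * ((√(x - a) * √(b - x) : ℝ) : ℂ) := by
  simp only [← Complex.ofReal_sub]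
  rw [csqrt_ofReal_of_pos (sub_pos.2 hx.1), csqrt_ofReal_of_neg (sub_neg.2 hx.2), neg_sub]
  push_cast
  ring

theorem sqrt_abs_eval_endpointPoly {d : ℕ} (a b : Fin d → ℝ) (x : ℝ) :
    √|(endpointPoly a b).eval x| = ∏ j, (√|x - a j| * √|x - b j|) := by
  rw [eval_endpointPoly, Finset.abs_prod, Real.sqrt_prod _ fun _ _ => abs_nonneg _]
  exact Finset.prod_congr rfl fun j _ => by rw [abs_mul, Real.sqrt_mul (abs_nonneg _)]

/-- An interval to the left of x contributes two positive roots to μ; an interval to the right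
contributes two imaginary ones, hence i² = −1. -/
theorem re_etaBranch_of_notMem {d : ℕ} {a b : Fin d → ℝ} (h : IsIntervalSystem a b) (k : ℝ[X])
    {x : ℝ} (hx : ∀ j, x ∉ Set.Icc (a j) (b j)) :
    (etaBranch a b k x).re = (∏ j, if a j < x then (1 : ℝ) else -1) *
      (k.eval x / √|(endpointPoly a b).eval x|) := by
  have hσ : (∏ j, if a j < x then (1 : ℝ) else -1)⁻¹ = ∏ j, if a j < x then (1 : ℝ) else -1 := by
    rw [← Finset.prod_inv_distrib]
    exact Finset.prod_congr rfl fun j _ => by split_ifs <;> norm_num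
  rw [etaBranch, Finset.prod_congr rfl fun j _ => csqrt_mul_csqrt_of_notMem_Icc (h.1 j) (hx j),
    ← Complex.ofReal_prod, Finset.prod_mul_distrib, ← sqrt_abs_eval_endpointPoly]
  have : aeval (x : ℂ) k = ((k.eval x : ℝ) : ℂ) := (Polynomial.ofReal_eval (K := ℂ) k x).symm
  rw [this, ← Complex.ofReal_div, Complex.ofReal_re, div_mul_eq_div_div,
    div_eq_mul_inv (k.eval x), hσ]
  ring

/-- Exactly one pair of roots contributes a factor i and all others are real, so the quotient is
purely imaginary. -/
theorem re_etaBranch_of_mem {d : ℕ} {a b : Fin d → ℝ} (h : IsIntervalSystem a b) (k : ℝ[X])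
    {x : ℝ} {j : Fin d} (hx : x ∈ Set.Ioo (a j) (b j)) : (etaBranch a b k x).re = 0 := by
  have hout : ∀ l, l ≠ j → x ∉ Set.Icc (a l) (b l) := by
    intro l hl hxl
    rcases lt_or_gt_of_ne hl with hl | hl
    · exact absurd (hxl.2.trans_lt (h.2 _ _ hl)) hx.1.not_gt
    · exact absurd (hx.2.trans (h.2 _ _ hl)) hxl.1.not_gt
  have : aeval (x : ℂ) k = ((k.eval x : ℝ) : ℂ) := (Polynomial.ofReal_eval (K := ℂ) k x).symm
  rw [etaBranch, this, ← Finset.mul_prod_erase _ _ (Finset.mem_univ j),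
    csqrt_mul_csqrt_of_mem_Ioo hx,
    Finset.prod_congr rfl fun l hl =>
      csqrt_mul_csqrt_of_notMem_Icc (h.1 l) (hout l (Finset.ne_of_mem_erase hl)),
    ← Complex.ofReal_prod, mul_assoc, ← Complex.ofReal_mul, mul_comm Complex.I, ← div_div,
    ← Complex.ofReal_div, Complex.div_I, Complex.neg_re, Complex.re_ofReal_mul, Complex.I_re,
    mul_zero, neg_zero]

theorem integrable_re_etaBranch_sub {d : ℕ} (hd : 1 ≤ d) {a b : Fin d → ℝ}
    (h : IsIntervalSystem a b) {k : ℝ[X]} (hk : k.Monic) (hn : k.natDegree = d - 1) :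
    Integrable (fun x : ℝ => (etaBranch a b k x).re - ((x : ℂ) + Complex.I)⁻¹.re) ∧
      ∫ x : ℝ, ((etaBranch a b k x).re - ((x : ℂ) + Complex.I)⁻¹.re) = 0 := by
  obtain ⟨h1, h2⟩ := integral_etaBranch_sub_eq_zero hd h hk hn
  refine ⟨by simpa using h1.re, ?_⟩
  have := integral_re h1
  rw [h2] at this
  simpa using this

theorem intervalIntegrable_re_etaBranch {d : ℕ} (hd : 1 ≤ d) {a b : Fin d → ℝ}
    (h : IsIntervalSystem a b) {k : ℝ[X]} (hk : k.Monic) (hn : k.natDegree = d - 1) (u v : ℝ) :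
    IntervalIntegrable (fun x : ℝ => (etaBranch a b k x).re) volume u v := by
  have hc : Continuous fun x : ℝ => ((x : ℂ) + Complex.I)⁻¹.re := by
    refine Complex.continuous_re.comp (Continuous.inv₀ (by fun_prop) fun x h0 => ?_)
    have := congrArg Complex.im h0
    simp at this
  have := (integrable_re_etaBranch_sub hd h hk hn).1.intervalIntegrable.add
    (hc.intervalIntegrable u v)
  simpa using this

/-- The sign relating Re(k/μ) to k/√|P| is constant on a gap, so the normalisation of η carries
over. -/
theorem integral_re_etaBranch_gap {d : ℕ} {a b : Fin d → ℝ}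
    (h : IsIntervalSystem a b) {k : ℝ[X]} (hk : IsEtaNumerator a b k) {i j : Fin d}
    (hij : (i : ℕ) + 1 = j) : ∫ x in (b i)..(a j), (etaBranch a b k x).re = 0 := by
  have hlt : b i < a j := h.2 i j (by rw [Fin.lt_def]; omega)
  have e : ∫ x in (b i)..(a j), (etaBranch a b k x).re =
      ∫ x in (b i)..(a j), (∏ l, if l ≤ i then (1 : ℝ) else -1) *
        (k.eval x / √|(endpointPoly a b).eval x|) := by
    refine intervalIntegral.integral_congr_Ioo_of_le hlt.le fun x hx => ?_
    have hl1 : ∀ l, l ≤ i → a l < x ∧ b l < x := fun l hl => by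
      have h2 := (h.right_strictMono.monotone hl).trans_lt hx.1
      exact ⟨(h.1 l).trans h2, h2⟩
    have hl2 : ∀ l, ¬ l ≤ i → x < a l := fun l hl =>
      hx.2.trans_le (h.left_strictMono.monotone (by rw [Fin.le_def] at hl ⊢; omega))
    have := re_etaBranch_of_notMem h k (x := x) fun l hl => by
      by_cases hli : l ≤ i
      · exact hl.2.not_gt (hl1 l hli).2
      · exact hl.1.not_gt (hl2 l hli)
    rw [this]
    congr 1
    refine Finset.prod_congr rfl fun l _ => ?_
    by_cases hli : l ≤ i
    · rw [if_pos hli, if_pos (hl1 l hli).1]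
    · rw [if_neg hli, if_neg (hl2 l hli).not_gt]
  rw [e, intervalIntegral.integral_const_mul, hk.2.2 i j hij, mul_zero]

theorem integral_re_etaBranch_hull {d : ℕ} {a b : Fin d → ℝ}
    (h : IsIntervalSystem a b) {k : ℝ[X]} (hk : IsEtaNumerator a b k) (n : ℕ) (hn : n < d) :
    ∫ x in (a ⟨0, by omega⟩)..(b ⟨n, hn⟩), (etaBranch a b k x).re = 0 := by
  have hint := intervalIntegrable_re_etaBranch (by omega) h hk.1 hk.2.1
  have hband : ∀ j, ∫ x in (a j)..(b j), (etaBranch a b k x).re = 0 := by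
    intro j
    rw [intervalIntegral.integral_congr_Ioo_of_le (g := fun _ => 0) (h.1 j).le
      fun x hx => re_etaBranch_of_mem h k hx]
    simp
  induction n with
  | zero => exact hband _
  | succ n ih =>
    rw [← intervalIntegral.integral_add_adjacent_intervals (b := a ⟨n + 1, hn⟩) (hint _ _)
      (hint _ _), ← intervalIntegral.integral_add_adjacent_intervals (b := b ⟨n, by omega⟩)
      (hint _ _) (hint _ _), ih, hband, integral_re_etaBranch_gap h hk rfl]
    simp

/-- For two interval systems with the same convex hull, the differentials have the same regularized
integral over the complement of the hull. -/
theorem outer_integrals_eq_zero {d : ℕ} (hd : 1 ≤ d) {a b b' : Fin d → ℝ}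
    (h : IsIntervalSystem a b) (h' : IsIntervalSystem a b')
    (hlast : b' ⟨d - 1, by omega⟩ = b ⟨d - 1, by omega⟩) {k k' : ℝ[X]}
    (hk : IsEtaNumerator a b k) (hk' : IsEtaNumerator a b' k') :
    Integrable (fun x : ℝ => (etaBranch a b k x).re - (etaBranch a b' k' x).re) ∧
    (∫ x in Set.Iic (a ⟨0, by omega⟩), ((etaBranch a b k x).re - (etaBranch a b' k' x).re)) +
      ∫ x in Set.Ioi (b ⟨d - 1, by omega⟩),
        ((etaBranch a b k x).re - (etaBranch a b' k' x).re) = 0 := by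
  obtain ⟨i1, e1⟩ := integrable_re_etaBranch_sub hd h hk.1 hk.2.1
  obtain ⟨i2, e2⟩ := integrable_re_etaBranch_sub hd h' hk'.1 hk'.2.1
  have hG : Integrable (fun x : ℝ => (etaBranch a b k x).re - (etaBranch a b' k' x).re) := by
    exact (i1.sub i2).congr (Eventually.of_forall fun x => by simp)
  have e : ∫ x : ℝ, ((etaBranch a b k x).re - (etaBranch a b' k' x).re) = 0 := by
    have := integral_sub i1 i2
    rw [e1, e2] at this
    simpa using this
  refine ⟨hG, ?_⟩
  have hmid : ∫ x in (a ⟨0, by omega⟩)..(b ⟨d - 1, by omega⟩),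
      ((etaBranch a b k x).re - (etaBranch a b' k' x).re) = 0 := by
    rw [intervalIntegral.integral_sub
      (intervalIntegrable_re_etaBranch hd h hk.1 hk.2.1 _ _)
      (intervalIntegrable_re_etaBranch hd h' hk'.1 hk'.2.1 _ _),
      integral_re_etaBranch_hull h hk (d - 1) (by omega)]
    have := integral_re_etaBranch_hull h' hk' (d - 1) (by omega)
    rw [hlast] at this
    rw [this, sub_zero]
  rw [← intervalIntegral.integral_Iic_sub_Iic hG.integrableOn hG.integrableOn, sub_eq_zero] at hmid
  rw [← hmid, intervalIntegral.integral_Iic_add_Ioi hG.integrableOn hG.integrableOn, e]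

theorem re_etaBranch_right {d : ℕ} (hd : 1 ≤ d) {a b : Fin d → ℝ} (h : IsIntervalSystem a b)
    (k : ℝ[X]) {x : ℝ} (hx : b ⟨d - 1, by omega⟩ < x) :
    (etaBranch a b k x).re = k.eval x / √|(endpointPoly a b).eval x| := by
  have hb : ∀ l, b l < x := fun l =>
    (h.right_strictMono.monotone (by rw [Fin.le_def]; simp; omega)).trans_lt hx
  rw [re_etaBranch_of_notMem h k fun l hl => hl.2.not_gt (hb l),
    Finset.prod_eq_one fun l _ => if_pos ((h.1 l).trans (hb l)), one_mul]

theorem re_etaBranch_left {d : ℕ} (hd : 1 ≤ d) {a b : Fin d → ℝ} (h : IsIntervalSystem a b)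
    (k : ℝ[X]) {x : ℝ} (hx : x < a ⟨0, by omega⟩) :
    (etaBranch a b k x).re = (-1) ^ d * (k.eval x / √|(endpointPoly a b).eval x|) := by
  have ha : ∀ l, x < a l := fun l =>
    hx.trans_le (h.left_strictMono.monotone (by rw [Fin.le_def]; simp))
  rw [re_etaBranch_of_notMem h k fun l hl => hl.1.not_gt (ha l),
    Finset.prod_congr rfl fun l _ => if_neg (ha l).not_gt]
  simp

/-! ### Gaps and the zeros of the numerator -/

/-- The left end of the `n`-th gap is the right end of this interval. -/
def gapLeft {d : ℕ} (n : Fin (d - 1)) : Fin d := ⟨n, by omega⟩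

/-- The right end of the `n`-th gap is the left end of this interval. -/
def gapRight {d : ℕ} (n : Fin (d - 1)) : Fin d := ⟨n + 1, by omega⟩

/-- The `n`-th gap of an interval system. -/
def gap {d : ℕ} (a b : Fin d → ℝ) (n : Fin (d - 1)) : Set ℝ :=
  Set.Ioo (b (gapLeft n)) (a (gapRight n))

theorem IsIntervalSystem.gap_lt {d : ℕ} {a b : Fin d → ℝ} (h : IsIntervalSystem a b)
    (n : Fin (d - 1)) : b (gapLeft n) < a (gapRight n) :=
  h.2 _ _ (by rw [Fin.lt_def]; simp [gapLeft, gapRight])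

theorem IsIntervalSystem.gapRight_le {d : ℕ} {a b : Fin d → ℝ} (h : IsIntervalSystem a b)
    {n : Fin (d - 1)} {j : Fin d} (hj : gapLeft n < j) : a (gapRight n) ≤ a j :=
  h.left_strictMono.monotone (by rw [Fin.lt_def] at hj; rw [Fin.le_def]; exact hj)

theorem IsIntervalSystem.le_gapLeft {d : ℕ} {a b : Fin d → ℝ} (h : IsIntervalSystem a b)
    {n : Fin (d - 1)} {j : Fin d} (hj : j ≤ gapLeft n) : b j ≤ b (gapLeft n) :=
  h.right_strictMono.monotone hj

theorem IsIntervalSystem.gapRight_le_gapLeft {d : ℕ} {a b : Fin d → ℝ} (h : IsIntervalSystem a b)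
    {n m : Fin (d - 1)} (hnm : n < m) : a (gapRight n) < b (gapLeft m) :=
  (h.gapRight_le (show gapLeft n < gapLeft m from hnm)).trans_lt (h.1 _)

theorem IsIntervalSystem.disjoint_gap {d : ℕ} {a b : Fin d → ℝ} (h : IsIntervalSystem a b)
    {n m : Fin (d - 1)} (hnm : n ≠ m) {x y : ℝ} (hx : x ∈ gap a b n) (hy : y ∈ gap a b m) :
    x ≠ y := by
  rcases lt_or_gt_of_ne hnm with hlt | hlt
  · exact (hx.2.trans ((h.gapRight_le_gapLeft hlt).trans hy.1)).ne
  · exact (hy.2.trans ((h.gapRight_le_gapLeft hlt).trans hx.1)).ne'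

theorem IsIntervalSystem.notMem_gap_of_mem_Icc {d : ℕ} {a b : Fin d → ℝ}
    (h : IsIntervalSystem a b) {j : Fin d} {x : ℝ} (hx : x ∈ Set.Icc (a j) (b j))
    (n : Fin (d - 1)) : x ∉ gap a b n := by
  intro hn
  rcases lt_or_ge (gapLeft n) j with hj | hj
  · exact absurd (hn.2.trans_le ((h.gapRight_le hj).trans hx.1)) (lt_irrefl _)
  · exact absurd (hn.1.trans_le (hx.2.trans (h.le_gapLeft hj))) (lt_irrefl _)

theorem IsIntervalSystem.right_le_last {d : ℕ} {a b : Fin d → ℝ} (h : IsIntervalSystem a b)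
    (hd : 1 ≤ d) (j : Fin d) : b j ≤ b ⟨d - 1, by omega⟩ :=
  h.right_strictMono.monotone (by rw [Fin.le_def]; simp; omega)

theorem IsIntervalSystem.first_le_left {d : ℕ} {a b : Fin d → ℝ} (h : IsIntervalSystem a b)
    (hd : 1 ≤ d) (j : Fin d) : a ⟨0, by omega⟩ ≤ a j :=
  h.left_strictMono.monotone (by rw [Fin.le_def]; simp)

theorem IsIntervalSystem.gap_subset_hull {d : ℕ} {a b : Fin d → ℝ} (h : IsIntervalSystem a b)
    (hd : 1 ≤ d) {n : Fin (d - 1)} {x : ℝ} (hx : x ∈ gap a b n) :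
    a ⟨0, by omega⟩ < x ∧ x < b ⟨d - 1, by omega⟩ :=
  ⟨(h.first_le_left hd _).trans_lt ((h.1 _).trans hx.1),
    hx.2.trans ((h.1 _).trans_le (h.right_le_last hd _))⟩

theorem mul_sub_pos_of_notMem_Ioo {u v r s x : ℝ} (hr : r ∈ Set.Ioo u v) (hs : s ∈ Set.Ioo u v)
    (hx : x ∉ Set.Ioo u v) : 0 < (x - r) * (x - s) := by
  rcases le_or_gt x u with h | h
  · exact mul_pos_of_neg_of_neg (by linarith [hr.1]) (by linarith [hs.1])
  · have h2 : v ≤ x := by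
      by_contra! h2
      exact hx ⟨h, h2⟩
    exact mul_pos (by linarith [hr.2]) (by linarith [hs.2])

/-- The numerator of `η` has exactly one root in each gap. -/
theorem IsEtaNumerator.exists_roots {d : ℕ} {a b : Fin d → ℝ} (h : IsIntervalSystem a b)
    {k : ℝ[X]} (hk : IsEtaNumerator a b k) :
    ∃ r : Fin (d - 1) → ℝ, (∀ n, r n ∈ gap a b n) ∧ k = ∏ n, (X - C (r n)) := by
  have hroot : ∀ n : Fin (d - 1), ∃ x ∈ gap a b n, k.eval x = 0 := fun n =>
    exists_root_of_gap_integral h rfl k (hk.2.2 _ _ rfl)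
  choose r hr hr0 using hroot
  refine ⟨r, hr, ?_⟩
  have hinj : Function.Injective r := fun n m hnm => by
    by_contra hne
    exact h.disjoint_gap hne (hr n) (hr m) hnm
  have hdvd : ∏ n, (X - C (r n)) ∣ k := Finset.prod_dvd_of_coprime
    (fun n _ m _ hnm => pairwise_coprime_X_sub_C hinj hnm) fun n _ => dvd_iff_isRoot.2 (hr0 n)
  refine (eq_of_monic_of_dvd_of_natDegree_le (monic_prod_X_sub_C _ _) hk.1 hdvd ?_)
  rw [hk.2.1, natDegree_finsetProd_X_sub_C_eq_card, Finset.card_univ, Fintype.card_fin]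

/-- Roots lying in the same gap are on the same side of x. It applies to k and k' together because
moving an endpoint to the right only shrinks gaps. -/
theorem eval_mul_eval_pos {d : ℕ} {a b : Fin d → ℝ} {r r' : Fin (d - 1) → ℝ}
    (hr : ∀ n, r n ∈ gap a b n) (hr' : ∀ n, r' n ∈ gap a b n) {x : ℝ} (hx : ∀ n, x ∉ gap a b n) :
    0 < (∏ n, (X - C (r n))).eval x * (∏ n, (X - C (r' n))).eval x := by
  simp only [eval_prod, eval_sub, eval_X, eval_C, ← Finset.prod_mul_distrib]
  exact Finset.prod_pos fun n _ => mul_sub_pos_of_notMem_Ioo (hr n) (hr' n) (hx n)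

theorem IsIntervalSystem.gapLeft_notMem_gap {d : ℕ} {a b : Fin d → ℝ}
    (h : IsIntervalSystem a b) (i n : Fin (d - 1)) : b (gapLeft i) ∉ gap a b n :=
  h.notMem_gap_of_mem_Icc (Set.right_mem_Icc.2 (h.1 _).le) n

theorem IsIntervalSystem.gapRight_notMem_gap {d : ℕ} {a b : Fin d → ℝ}
    (h : IsIntervalSystem a b) (i n : Fin (d - 1)) : a (gapRight i) ∉ gap a b n :=
  h.notMem_gap_of_mem_Icc (Set.left_mem_Icc.2 (h.1 _).le) n

/-- Only the root inside this gap separates its two ends. -/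
theorem eval_gap_ends_mul_neg {d : ℕ} {a b : Fin d → ℝ} (h : IsIntervalSystem a b)
    {r : Fin (d - 1) → ℝ} (hr : ∀ n, r n ∈ gap a b n) (i : Fin (d - 1)) :
    (∏ n, (X - C (r n))).eval (b (gapLeft i)) * (∏ n, (X - C (r n))).eval (a (gapRight i)) < 0 := by
  simp only [eval_prod, eval_sub, eval_X, eval_C, ← Finset.prod_mul_distrib]
  rw [← Finset.mul_prod_erase _ _ (Finset.mem_univ i)]
  refine mul_neg_of_neg_of_pos (mul_neg_of_neg_of_pos ?_ ?_) (Finset.prod_pos fun n hn => ?_)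
  · linarith [(hr i).1]
  · linarith [(hr i).2]
  · have hrn := hr n
    rcases lt_or_gt_of_ne (Finset.ne_of_mem_erase hn) with hlt | hlt
    · have h1 := h.gapRight_le_gapLeft hlt
      have h2 := h.gap_lt i
      exact mul_pos (by linarith [hrn.2]) (by linarith [hrn.2])
    · have h1 := h.gapRight_le_gapLeft hlt
      have h2 := h.gap_lt i
      exact mul_pos_of_neg_of_neg (by linarith [hrn.1]) (by linarith [hrn.1])

theorem exists_zero_of_intervalIntegral_eq_zero {f : ℝ → ℝ} {u v : ℝ} (huv : u < v)
    (hf : ContinuousOn f (Set.Ioo u v)) (hint : IntervalIntegrable f volume u v)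
    (h0 : ∫ x in u..v, f x = 0) : ∃ x ∈ Set.Ioo u v, f x = 0 := by
  by_contra! hne
  have hsign : (∀ x ∈ Set.Ioo u v, 0 < f x) ∨ ∀ x ∈ Set.Ioo u v, f x < 0 := by
    by_contra! hcon
    obtain ⟨⟨x, hx, hx0⟩, y, hy, hy0⟩ := hcon
    obtain ⟨z, hz, hz0⟩ := isPreconnected_Ioo.intermediate_value hx hy hf ⟨hx0, hy0⟩
    exact hne z hz hz0
  rcases hsign with hs | hs
  · exact (intervalIntegral.intervalIntegral_pos_of_pos_on hint hs huv).ne' h0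
  · have := intervalIntegral.intervalIntegral_pos_of_pos_on hint.neg
      (fun x hx => neg_pos.2 (hs x hx)) huv
    have h2 : ∫ x in u..v, -f x = 0 := by rw [intervalIntegral.integral_neg, h0, neg_zero]
    exact this.ne' h2

theorem exists_zero_of_mul_neg {f : ℝ → ℝ} {u v : ℝ} (huv : u < v)
    (hf : ContinuousOn f (Set.Icc u v)) (h : f u * f v < 0) : ∃ x ∈ Set.Ioo u v, f x = 0 := by
  rcases mul_neg_iff.1 h with ⟨h1, h2⟩ | ⟨h1, h2⟩
  · exact intermediate_value_Ioo' huv.le hf ⟨h2, h1⟩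
  · exact intermediate_value_Ioo huv.le hf ⟨h1, h2⟩

/-! ### The comparison polynomial -/

theorem endpointPoly_update_mul {d : ℕ} (a b : Fin d → ℝ) (m : Fin d) (β : ℝ) :
    endpointPoly a (Function.update b m β) * (X - C (b m)) =
      endpointPoly a b * (X - C β) := by
  rw [endpointPoly, endpointPoly, ← Finset.mul_prod_erase _ _ (Finset.mem_univ m),
    ← Finset.mul_prod_erase _ (fun j => (X - C (a j)) * (X - C (b j))) (Finset.mem_univ m),
    Function.update_self, Finset.prod_congr rfl fun j hj => by
      rw [Function.update_of_ne (Finset.ne_of_mem_erase hj)]]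
  ring

theorem sqrt_endpointPoly_update_mul {d : ℕ} (a b : Fin d → ℝ) (m : Fin d) (β x : ℝ) :
    √|(endpointPoly a (Function.update b m β)).eval x| * √|x - b m| =
      √|(endpointPoly a b).eval x| * √|x - β| := by
  have := congrArg (fun p : ℝ[X] => √|p.eval x|) (endpointPoly_update_mul a b m β)
  simpa only [eval_mul, eval_sub, eval_X, eval_C, abs_mul, Real.sqrt_mul (abs_nonneg _)] using this

/-- The polynomial whose sign compares the densities `|k| / √|x - b|` and `|k'| / √|x - β|`. -/
noncomputable def comparisonPoly (k k' : ℝ[X]) (b β : ℝ) : ℝ[X] :=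
  k ^ 2 * (X - C β) - k' ^ 2 * (X - C b)

theorem mul_sub_pos_of_outside {b β x : ℝ} (hbβ : b < β) (hx : x < b ∨ β < x) :
    0 < (x - b) * (x - β) := by
  rcases hx with h | h
  · exact mul_pos_of_neg_of_neg (by linarith) (by linarith)
  · exact mul_pos (by linarith) (by linarith)

/-- Off [b, β] the numbers x − b and x − β have the same sign; the extra factor x − b cancels it and
leaves a difference of squares that compares the two densities. -/
theorem sub_mul_comparisonPoly {k k' : ℝ[X]} {b β x : ℝ} (hbβ : b < β) (hx : x < b ∨ β < x) :
    (x - b) * (comparisonPoly k k' b β).eval x =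
      |x - b| * ((|k.eval x| * √|x - β|) ^ 2 - (|k'.eval x| * √|x - b|) ^ 2) := by
  rw [mul_pow, mul_pow, sq_abs, sq_abs, Real.sq_sqrt (abs_nonneg _), Real.sq_sqrt (abs_nonneg _)]
  simp only [comparisonPoly, eval_sub, eval_mul, eval_pow, eval_X, eval_C]
  rcases hx with h | h
  · rw [abs_of_neg (by linarith), abs_of_neg (by linarith)]
    ring
  · rw [abs_of_pos (by linarith), abs_of_pos (by linarith)]

theorem comparisonPoly_isRoot_of_sq_eq {k k' : ℝ[X]} {b β x : ℝ} (hbβ : b < β)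
    (hx : x < b ∨ β < x) (h : (k.eval x * √|x - β|) ^ 2 = (k'.eval x * √|x - b|) ^ 2) :
    (comparisonPoly k k' b β).IsRoot x := by
  have h1 := sub_mul_comparisonPoly (k := k) (k' := k') hbβ hx
  have h2 : x - b ≠ 0 := left_ne_zero_of_mul (mul_sub_pos_of_outside hbβ hx).ne'
  rw [mul_pow, mul_pow, sq_abs, sq_abs, ← mul_pow, ← mul_pow, h, sub_self, mul_zero] at h1
  exact (mul_eq_zero.1 h1).resolve_left h2

/-- Both products are monic of degree 2(d − 1) + 1, so the leading terms cancel. -/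
theorem natDegree_comparisonPoly_le {d : ℕ} {k k' : ℝ[X]} (hk : k.Monic) (hk' : k'.Monic)
    (hn : k.natDegree = d - 1) (hn' : k'.natDegree = d - 1) (b β : ℝ) :
    (comparisonPoly k k' b β).natDegree ≤ 2 * (d - 1) := by
  have m1 : (k ^ 2 * (X - C β)).Monic := (hk.pow 2).mul (monic_X_sub_C β)
  have m2 : (k' ^ 2 * (X - C b)).Monic := (hk'.pow 2).mul (monic_X_sub_C b)
  have e1 : (k ^ 2 * (X - C β)).natDegree = 2 * (d - 1) + 1 := by
    rw [(hk.pow 2).natDegree_mul (monic_X_sub_C β), hk.natDegree_pow, natDegree_X_sub_C, hn]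
  have e2 : (k' ^ 2 * (X - C b)).natDegree = 2 * (d - 1) + 1 := by
    rw [(hk'.pow 2).natDegree_mul (monic_X_sub_C b), hk'.natDegree_pow, natDegree_X_sub_C, hn']
  have hlt := degree_sub_lt_left (p := k ^ 2 * (X - C β)) (q := k' ^ 2 * (X - C b))
    (by rw [degree_eq_natDegree m1.ne_zero, degree_eq_natDegree m2.ne_zero, e1, e2]) m1.ne_zero
    (by rw [m1.leadingCoeff, m2.leadingCoeff])
  rw [degree_eq_natDegree m1.ne_zero, e1] at hlt
  rcases eq_or_ne (comparisonPoly k k' b β) 0 with h0 | h0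
  · simp [h0]
  · exact Nat.lt_succ_iff.1 ((natDegree_lt_iff_degree_lt h0).2 hlt)

/-- If u = v, the two equations together force k(u) = k'(u) = 0, and then (X − u)² divides both
terms. So coinciding zeros are counted twice. -/
theorem sub_mul_sub_dvd_comparisonPoly {k k' : ℝ[X]} {b β u v : ℝ} (hbβ : b < β)
    (hu : u < b ∨ β < u) (hv : v < b ∨ β < v)
    (h1 : k.eval u * √|u - β| = k'.eval u * √|u - b|)
    (h2 : k.eval v * √|v - β| = -(k'.eval v * √|v - b|)) :
    (X - C u) * (X - C v) ∣ comparisonPoly k k' b β := by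
  have r1 := comparisonPoly_isRoot_of_sq_eq hbβ hu (by rw [h1])
  have r2 := comparisonPoly_isRoot_of_sq_eq hbβ hv (by rw [h2, neg_sq])
  rcases eq_or_ne u v with rfl | huv
  · have hs := mul_sub_pos_of_outside hbβ hu
    have s1 : √|u - b| ≠ 0 :=
      (Real.sqrt_pos.2 (abs_pos.2 (left_ne_zero_of_mul hs.ne'))).ne'
    have s2 : √|u - β| ≠ 0 :=
      (Real.sqrt_pos.2 (abs_pos.2 (right_ne_zero_of_mul hs.ne'))).ne'
    have k0 : k.eval u = 0 := (mul_eq_zero.1 (by linarith : k.eval u * √|u - β| = 0)).resolve_right s2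
    have k0' : k'.eval u = 0 :=
      (mul_eq_zero.1 (by linarith : k'.eval u * √|u - b| = 0)).resolve_right s1
    rw [← sq]
    exact dvd_sub (Dvd.dvd.mul_right (pow_dvd_pow_of_dvd (dvd_iff_isRoot.2 k0) 2) _)
      (Dvd.dvd.mul_right (pow_dvd_pow_of_dvd (dvd_iff_isRoot.2 k0') 2) _)
  · exact (isCoprime_X_sub_C_of_isUnit_sub (sub_ne_zero.2 huv).isUnit).mul_dvd
      (dvd_iff_isRoot.2 r1) (dvd_iff_isRoot.2 r2)

/-! ### Zeros of the comparison polynomial when one endpoint moves -/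

section Move

variable {d : ℕ} {a b : Fin d → ℝ} {m : Fin d} {β : ℝ}

theorem gap_update_subset (hβ : b m < β) (n : Fin (d - 1)) :
    gap a (Function.update b m β) n ⊆ gap a b n := by
  intro x hx
  refine ⟨lt_of_le_of_lt ?_ hx.1, hx.2⟩
  rcases eq_or_ne (gapLeft n) m with rfl | hne
  · rw [Function.update_self]
    exact hβ.le
  · rw [Function.update_of_ne hne]

theorem outside_of_mem_Icc_of_ne (h : IsIntervalSystem a b)
    (h' : IsIntervalSystem a (Function.update b m β)) {j : Fin d} (hj : j ≠ m) {x : ℝ}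
    (hx : x ∈ Set.Icc (a j) (b j)) : x < b m ∨ β < x := by
  rcases lt_or_gt_of_ne hj with hlt | hlt
  · exact Or.inl (hx.2.trans_lt (h.right_strictMono hlt))
  · refine Or.inr (lt_of_lt_of_le ?_ hx.1)
    simpa using h'.2 m j hlt

theorem outside_of_mem_gap_of_ne (h : IsIntervalSystem a b)
    (h' : IsIntervalSystem a (Function.update b m β)) {n : Fin (d - 1)} (hn : gapLeft n ≠ m)
    {x : ℝ} (hx : x ∈ Set.Icc (b (gapLeft n)) (a (gapRight n))) : x < b m ∨ β < x := by
  rcases lt_or_gt_of_ne hn with hlt | hlt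
  · exact Or.inl (hx.2.trans_lt ((h.gapRight_le hlt).trans_lt (h.1 m)))
  · refine Or.inr (lt_of_lt_of_le ?_ hx.1)
    have := h'.right_strictMono hlt
    rwa [Function.update_self, Function.update_of_ne hn] at this

theorem endpointPoly_eval_ne_zero_of_mem_gap (h : IsIntervalSystem a b) {n : Fin (d - 1)} {x : ℝ}
    (hx : x ∈ gap a b n) : (endpointPoly a b).eval x ≠ 0 :=
  endpointPoly_ne_zero_of_gap h (i := gapLeft n) (j := gapRight n) rfl hx

/-- The zero u comes from the difference of the two differentials, which has integral zero over the
gap. The zero v comes from k√|x − β| + k'√|x − b|: at the ends of the gap k and k' have equal signs,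
and k changes sign from one end to the other. -/
theorem exists_comparisonPoly_factor_of_gap (h : IsIntervalSystem a b) (hβ : b m < β)
    (h' : IsIntervalSystem a (Function.update b m β)) {k k' : ℝ[X]} (hk : IsEtaNumerator a b k)
    (hk' : IsEtaNumerator a (Function.update b m β) k') {n : Fin (d - 1)} (hn : gapLeft n ≠ m) :
    ∃ u ∈ gap a b n, ∃ v ∈ gap a b n,
      (X - C u) * (X - C v) ∣ comparisonPoly k k' (b m) β := by
  have hb' : Function.update b m β (gapLeft n) = b (gapLeft n) := Function.update_of_ne hn _ _
  have hlt := h.gap_lt n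
  have hout : ∀ x ∈ gap a b n, x < b m ∨ β < x := fun x hx =>
    outside_of_mem_gap_of_ne h h' hn ⟨hx.1.le, hx.2.le⟩
  have hne : ∀ x ∈ gap a b n, √|(endpointPoly a b).eval x| ≠ 0 := fun x hx =>
    (Real.sqrt_pos.2 (abs_pos.2 (endpointPoly_eval_ne_zero_of_mem_gap h hx))).ne'
  have hgap : gap a (Function.update b m β) n = gap a b n := by rw [gap, hb', gap]
  have hne' : ∀ x ∈ gap a b n, √|(endpointPoly a (Function.update b m β)).eval x| ≠ 0 :=
    fun x hx => (Real.sqrt_pos.2 (abs_pos.2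
      (endpointPoly_eval_ne_zero_of_mem_gap h' (by rwa [hgap])))).ne'
  have i1 := intervalIntegrable_eta_gap h (i := gapLeft n) (j := gapRight n) rfl k
  have i2 := intervalIntegrable_eta_gap h' (i := gapLeft n) (j := gapRight n) rfl k'
  have e1 := hk.2.2 (gapLeft n) (gapRight n) rfl
  have e2 := hk'.2.2 (gapLeft n) (gapRight n) rfl
  rw [hb'] at i2 e2
  obtain ⟨u, hu, hu0⟩ := exists_zero_of_intervalIntegral_eq_zero hlt
    (f := fun x => k.eval x / √|(endpointPoly a b).eval x| -
      k'.eval x / √|(endpointPoly a (Function.update b m β)).eval x|)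
    (ContinuousOn.sub (ContinuousOn.div k.continuousOn (by fun_prop) hne)
      (ContinuousOn.div k'.continuousOn (by fun_prop) hne')) (i1.sub i2)
    (by rw [intervalIntegral.integral_sub i1 i2, e1, e2, sub_zero])
  obtain ⟨r, hr, hkr⟩ := hk.exists_roots h
  obtain ⟨r', hr', hkr'⟩ := hk'.exists_roots h'
  have hr'' : ∀ n, r' n ∈ gap a b n := fun n => gap_update_subset hβ n (hr' n)
  have hend : ∀ x, (∀ i, x ∉ gap a b i) → (x < b m ∨ β < x) →
      0 < k.eval x * (k.eval x * √|x - β| + k'.eval x * √|x - b m|) := by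
    intro x hx hxo
    have p1 := eval_mul_eval_pos hr hr'' hx
    rw [← hkr, ← hkr'] at p1
    have p2 : 0 < √|x - β| := Real.sqrt_pos.2
      (abs_pos.2 (right_ne_zero_of_mul (mul_sub_pos_of_outside hβ hxo).ne'))
    have p3 : 0 < k.eval x * k.eval x := mul_self_pos.2 (left_ne_zero_of_mul p1.ne')
    have p4 := mul_pos p3 p2
    have p5 := mul_nonneg p1.le (Real.sqrt_nonneg |x - b m|)
    nlinarith
  have hl := hend _ (h.gapLeft_notMem_gap n)
    (outside_of_mem_gap_of_ne h h' hn (Set.left_mem_Icc.2 hlt.le))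
  have hr0 := hend _ (h.gapRight_notMem_gap n)
    (outside_of_mem_gap_of_ne h h' hn (Set.right_mem_Icc.2 hlt.le))
  have hneg := eval_gap_ends_mul_neg h hr n
  rw [← hkr] at hneg
  obtain ⟨v, hv, hv0⟩ := exists_zero_of_mul_neg hlt
    (f := fun x => k.eval x * √|x - β| + k'.eval x * √|x - b m|)
    (by fun_prop) (by
      have := mul_pos hl hr0
      by_contra! hge
      have := mul_nonneg_of_nonpos_of_nonpos hneg.le (neg_nonpos.2 hge)
      nlinarith)
  refine ⟨u, hu, v, hv, sub_mul_sub_dvd_comparisonPoly hβ (hout u hu) (hout v hv) ?_ ?_⟩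
  -- Turns equality of k/√|P| and k'/√|P'| at u into a relation free of P and P', using √|P'|√|u −
  -- b| = √|P|√|u − β|.
  · have hs := sqrt_endpointPoly_update_mul a b m β u
    have hu1 := sub_eq_zero.1 hu0
    rw [div_eq_div_iff (hne u hu) (hne' u hu)] at hu1
    refine mul_right_cancel₀ (hne u hu) ?_
    linear_combination √|u - b m| * hu1 - k.eval u * hs
  · exact eq_neg_of_add_eq_zero_left hv0

/-- B collects the pairs of zeros found in the unmoved gaps; each pair has positive product at
points outside its gap. Hence R inherits at b_m the sign of Q(b_m) = k(b_m)²(b_m − β). -/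
theorem exists_comparisonPoly_eq_mul (h : IsIntervalSystem a b) (hβ : b m < β)
    (h' : IsIntervalSystem a (Function.update b m β)) {k k' : ℝ[X]} (hk : IsEtaNumerator a b k)
    (hk' : IsEtaNumerator a (Function.update b m β) k') :
    ∃ B R : ℝ[X], comparisonPoly k k' (b m) β = B * R ∧ R ≠ 0 ∧
      R.natDegree + 2 * (Finset.univ.filter fun n : Fin (d - 1) => gapLeft n ≠ m).card
        ≤ 2 * (d - 1) ∧
      (∀ x, (∀ n, gapLeft n ≠ m → x ∉ gap a b n) → 0 < B.eval x) ∧ R.eval (b m) < 0 := by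
  have hex : ∀ n : Fin (d - 1), ∃ p : ℝ × ℝ, gapLeft n ≠ m → p.1 ∈ gap a b n ∧ p.2 ∈ gap a b n ∧
      (X - C p.1) * (X - C p.2) ∣ comparisonPoly k k' (b m) β := by
    intro n
    by_cases hn : gapLeft n = m
    · exact ⟨0, fun h => absurd hn h⟩
    · obtain ⟨u, hu, v, hv, huv⟩ := exists_comparisonPoly_factor_of_gap h hβ h' hk hk' hn
      exact ⟨(u, v), fun _ => ⟨hu, hv, huv⟩⟩
  choose p hp using hex
  set s := Finset.univ.filter fun n : Fin (d - 1) => gapLeft n ≠ m with hs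
  have hmem : ∀ n ∈ s, gapLeft n ≠ m := fun n hn => (Finset.mem_filter.1 hn).2
  set B : ℝ[X] := ∏ n ∈ s, ((X - C (p n).1) * (X - C (p n).2)) with hB
  have hdvd : B ∣ comparisonPoly k k' (b m) β := by
    refine Finset.prod_dvd_of_coprime (fun n hn i hi hni => ?_) fun n hn => (hp n (hmem n hn)).2.2
    have hn1 := hp n (hmem n hn)
    have hi1 := hp i (hmem i hi)
    have key : ∀ x y : ℝ, x ∈ gap a b n → y ∈ gap a b i → IsCoprime (X - C x) (X - C y) :=
      fun x y hx hy => isCoprime_X_sub_C_of_isUnit_sub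
        (sub_ne_zero.2 (h.disjoint_gap hni hx hy)).isUnit
    exact IsCoprime.mul_left
      (IsCoprime.mul_right (key _ _ hn1.1 hi1.1) (key _ _ hn1.1 hi1.2.1))
      (IsCoprime.mul_right (key _ _ hn1.2.1 hi1.1) (key _ _ hn1.2.1 hi1.2.1))
  obtain ⟨R, hR⟩ := hdvd
  have hpos : ∀ x, (∀ n, gapLeft n ≠ m → x ∉ gap a b n) → 0 < B.eval x := by
    intro x hx
    rw [hB, eval_prod]
    refine Finset.prod_pos fun n hn => ?_
    simp only [eval_mul, eval_sub, eval_X, eval_C]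
    exact mul_sub_pos_of_notMem_Ioo (hp n (hmem n hn)).1 (hp n (hmem n hn)).2.1 (hx n (hmem n hn))
  have hbm : ∀ n, b m ∉ gap a b n := h.notMem_gap_of_mem_Icc (Set.right_mem_Icc.2 (h.1 m).le)
  have hneg : (comparisonPoly k k' (b m) β).eval (b m) < 0 := by
    obtain ⟨r, hr, hkr⟩ := hk.exists_roots h
    have := eval_mul_eval_pos hr hr hbm
    rw [← hkr] at this
    simp only [comparisonPoly, eval_sub, eval_mul, eval_X, eval_C, sub_self, mul_zero,
      sub_zero, sq]
    exact mul_neg_of_pos_of_neg this (by linarith)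
  have hRneg : R.eval (b m) < 0 := by
    rw [hR, eval_mul] at hneg
    exact neg_of_mul_neg_right hneg (hpos _ fun n _ => hbm n).le
  have hR0 : R ≠ 0 := fun h0 => by simp [h0] at hRneg
  refine ⟨B, R, hR, hR0, ?_, hpos, hRneg⟩
  have hBm : ∀ n ∈ s, ((X - C (p n).1) * (X - C (p n).2)).Monic := fun n _ =>
    (monic_X_sub_C _).mul (monic_X_sub_C _)
  have hBdeg : B.natDegree = 2 * s.card := by
    rw [hB, natDegree_prod_of_monic _ _ hBm, Finset.sum_congr rfl fun n _ =>
      (monic_X_sub_C (p n).1).natDegree_mul (monic_X_sub_C (p n).2)]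
    simp [mul_comm]
  have hdeg := natDegree_comparisonPoly_le hk.1 hk'.1 hk.2.1 hk'.2.1 (b m) β
  rw [hR, (monic_prod_of_monic _ _ hBm).natDegree_mul' hR0, hBdeg] at hdeg
  omega

theorem density_lt_of_sub_mul_comparisonPoly {k k' : ℝ[X]} (hβ : b m < β) {x : ℝ}
    (hx : x < b m ∨ β < x) (hN : (endpointPoly a b).eval x ≠ 0)
    (hN' : (endpointPoly a (Function.update b m β)).eval x ≠ 0) :
    (0 < (x - b m) * (comparisonPoly k k' (b m) β).eval x →
      |k'.eval x| / √|(endpointPoly a (Function.update b m β)).eval x| <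
        |k.eval x| / √|(endpointPoly a b).eval x|) ∧
    ((x - b m) * (comparisonPoly k k' (b m) β).eval x < 0 →
      |k.eval x| / √|(endpointPoly a b).eval x| <
        |k'.eval x| / √|(endpointPoly a (Function.update b m β)).eval x|) := by
  have p1 := Real.sqrt_pos.2 (abs_pos.2 hN)
  have p2 := Real.sqrt_pos.2 (abs_pos.2 hN')
  have hs := sqrt_endpointPoly_update_mul a b m β x
  have hout := mul_sub_pos_of_outside hβ hx
  have q0 := abs_pos.2 (left_ne_zero_of_mul hout.ne')
  have q1 : 0 < √|x - b m| := Real.sqrt_pos.2 q0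
  have q2 : 0 < √|x - β| := Real.sqrt_pos.2 (abs_pos.2 (right_ne_zero_of_mul hout.ne'))
  have conv : ∀ y z N N' s s' : ℝ, 0 < N → 0 < N' → 0 < s → 0 < s' → N' * s = N * s' →
      (y / N - z / N' = (y * s' - z * s) / (N * s')) := by
    intro y z N N' s s' hN hN' hs hs' e
    rw [sub_div, mul_div_mul_right _ _ hs'.ne', ← e, mul_div_mul_right _ _ hs.ne']
  have hconv := conv |k.eval x| |k'.eval x| _ _ _ _ p1 p2 q1 q2 hs
  rw [sub_mul_comparisonPoly hβ hx, ← sub_pos (b := |k'.eval x| / _), ← sub_neg (a := |k.eval x| / _),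
    hconv]
  constructor
  · intro h0
    have := (pos_iff_pos_of_mul_pos h0).1 q0
    refine div_pos (sub_pos.2 ?_) (mul_pos p1 q2)
    exact lt_of_pow_lt_pow_left₀ 2 (by positivity) (sub_pos.1 this)
  · intro h0
    have := neg_of_mul_neg_right h0 q0.le
    refine div_neg_of_neg_of_pos (sub_neg.2 ?_) (mul_pos p1 q2)
    exact lt_of_pow_lt_pow_left₀ 2 (by positivity) (sub_neg.1 this)

end Move

theorem IsIntervalSystem.eval_endpointPoly_ne_zero_of_mem_Ioo {d : ℕ} {a b : Fin d → ℝ}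
    (h : IsIntervalSystem a b) {j : Fin d} {x : ℝ} (hx : x ∈ Set.Ioo (a j) (b j)) :
    (endpointPoly a b).eval x ≠ 0 := by
  refine eval_endpointPoly_ne_zero_iff.2 fun l => ?_
  rcases lt_trichotomy l j with hlt | rfl | hlt
  · have h1 := (h.2 l j hlt).trans hx.1
    exact ⟨((h.1 l).trans h1).ne', h1.ne'⟩
  · exact ⟨hx.1.ne', hx.2.ne⟩
  · have h1 := hx.2.trans (h.2 j l hlt)
    exact ⟨h1.ne, (h1.trans (h.1 l)).ne⟩

theorem setIntegral_pos_of_pos_on {f : ℝ → ℝ} {s : Set ℝ} (hs : MeasurableSet s)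
    (hs0 : volume s ≠ 0) (hf : IntegrableOn f s) (hpos : ∀ x ∈ s, 0 < f x) :
    0 < ∫ x in s, f x := by
  have h0 : 0 ≤ᵐ[volume.restrict s] f := by
    filter_upwards [ae_restrict_mem hs] with x hx using (hpos x hx).le
  rw [setIntegral_pos_iff_support_of_nonneg_ae h0 hf]
  refine (pos_iff_ne_zero.2 hs0).trans_le (measure_mono fun x hx => ⟨?_, hx⟩)
  exact (hpos x hx).ne'

/-! ### Sign of the remaining factor and drop of the density -/

section Move

variable {d : ℕ} {a b : Fin d → ℝ} {m : Fin d} {β : ℝ}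

/-- All zeros of k lie inside the hull, so Re(k/μ) is |k|/√|P| to its right and −|k|/√|P| to its
left. Under the assumed signs both outer integrals, multiplied by σ, are positive, yet their sum is
zero. -/
theorem not_outer_sign_change (hd : 1 ≤ d) (h : IsIntervalSystem a b)
    (h' : IsIntervalSystem a (Function.update b m β))
    (hlast : Function.update b m β ⟨d - 1, by omega⟩ = b ⟨d - 1, by omega⟩)
    {k k' : ℝ[X]} (hk : IsEtaNumerator a b k) (hk' : IsEtaNumerator a (Function.update b m β) k')
    {σ : ℝ}
    (hright : ∀ x, b ⟨d - 1, by omega⟩ < x → 0 < σ * (|k.eval x| / √|(endpointPoly a b).eval x| -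
      |k'.eval x| / √|(endpointPoly a (Function.update b m β)).eval x|))
    (hleft : ∀ x, x < a ⟨0, by omega⟩ → σ * (|k.eval x| / √|(endpointPoly a b).eval x| -
      |k'.eval x| / √|(endpointPoly a (Function.update b m β)).eval x|) < 0) : False := by
  obtain ⟨hG, hsum⟩ := outer_integrals_eq_zero hd h h' hlast hk hk'
  have eright : ∀ {b : Fin d → ℝ} (h : IsIntervalSystem a b) {k : ℝ[X]},
      IsEtaNumerator a b k → ∀ x, b ⟨d - 1, by omega⟩ < x →
      (etaBranch a b k x).re = |k.eval x| / √|(endpointPoly a b).eval x| := by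
    intro b h k hk x hx
    obtain ⟨r, hr, hkr⟩ := hk.exists_roots h
    suffices h0 : 0 ≤ k.eval x by rw [re_etaBranch_right hd h k hx, abs_of_nonneg h0]
    rw [hkr, eval_prod]
    refine Finset.prod_nonneg fun n _ => ?_
    have := (h.gap_subset_hull hd (hr n)).2
    simp only [eval_sub, eval_X, eval_C]
    linarith
  have eleft : ∀ {b : Fin d → ℝ} (h : IsIntervalSystem a b) {k : ℝ[X]},
      IsEtaNumerator a b k → ∀ x, x < a ⟨0, by omega⟩ →
      (etaBranch a b k x).re = -(|k.eval x| / √|(endpointPoly a b).eval x|) := by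
    intro b h k hk x hx
    obtain ⟨r, hr, hkr⟩ := hk.exists_roots h
    have hneg : (-1) ^ (d - 1) * k.eval x = |k.eval x| := by
      rw [hkr, eval_prod, Finset.abs_prod]
      have : (-1 : ℝ) ^ (d - 1) = ∏ _n : Fin (d - 1), (-1 : ℝ) := by simp
      rw [this, ← Finset.prod_mul_distrib]
      refine Finset.prod_congr rfl fun n _ => ?_
      have := (h.gap_subset_hull hd (hr n)).1
      simp only [eval_sub, eval_X, eval_C]
      rw [abs_of_neg (by linarith)]
      ring
    have hpow : (-1 : ℝ) ^ d = -(-1) ^ (d - 1) := by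
      obtain ⟨e, rfl⟩ : ∃ e, d = e + 1 := ⟨d - 1, by omega⟩
      simp [pow_succ]
    rw [re_etaBranch_left hd h k hx, hpow, ← hneg]
    ring
  have hGσ := hG.const_mul σ
  have p1 := setIntegral_pos_of_pos_on (f := fun x => σ * ((etaBranch a b k x).re -
      (etaBranch a (Function.update b m β) k' x).re)) (s := Set.Ioi (b ⟨d - 1, by omega⟩))
    measurableSet_Ioi (by simp) hGσ.integrableOn fun x hx => by
      rw [eright h hk x hx, eright h' hk' x (by rw [hlast]; exact hx)]
      exact hright x hx
  have p2 := setIntegral_pos_of_pos_on (f := fun x => σ * ((etaBranch a b k x).re -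
      (etaBranch a (Function.update b m β) k' x).re)) (s := Set.Iio (a ⟨0, by omega⟩))
    measurableSet_Iio (by simp) hGσ.integrableOn fun x hx => by
      rw [eleft h hk x hx, eleft h' hk' x hx]
      have := hleft x hx
      linarith
  rw [integral_const_mul] at p1 p2
  rw [integral_Iic_eq_integral_Iio] at hsum
  have := congrArg (σ * ·) hsum
  simp only [mul_add, mul_zero] at this
  linarith

/-- No gap starts at b_m, so the zeros in the gaps use up the whole degree and the cofactor is a
negative constant. -/
theorem sub_mul_comparisonPoly_pos_of_last (h : IsIntervalSystem a b) (hβ : b m < β)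
    (h' : IsIntervalSystem a (Function.update b m β)) {k k' : ℝ[X]} (hk : IsEtaNumerator a b k)
    (hk' : IsEtaNumerator a (Function.update b m β) k') (hm : ∀ n, gapLeft n ≠ m) {x : ℝ}
    (hx : x < b m) (hxg : ∀ n, x ∉ gap a b n) :
    0 < (x - b m) * (comparisonPoly k k' (b m) β).eval x := by
  obtain ⟨B, R, hQ, -, hdeg, hB, hneg⟩ := exists_comparisonPoly_eq_mul h hβ h' hk hk'
  rw [Finset.filter_true_of_mem fun n _ => hm n, Finset.card_univ, Fintype.card_fin] at hdeg
  obtain ⟨c, rfl⟩ := natDegree_eq_zero.1 (by omega : R.natDegree = 0)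
  rw [eval_C] at hneg
  rw [hQ, eval_mul, eval_C]
  exact mul_pos_of_neg_of_neg (by linarith) (mul_neg_of_pos_of_neg (hB x fun n _ => hxg n) hneg)

/-- The cofactor R has degree at most 2. One of its zeros, y, lies in the shortened gap, and px + q
is what remains. The factor c = B(x)(x − b)(x − y) is positive because b and y are on the same side
of every admitted x. -/
theorem exists_affine_sign (h : IsIntervalSystem a b) (hβ : b m < β)
    (h' : IsIntervalSystem a (Function.update b m β)) {k k' : ℝ[X]} (hk : IsEtaNumerator a b k)
    (hk' : IsEtaNumerator a (Function.update b m β) k') {i : Fin (d - 1)} (hi : gapLeft i = m) :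
    ∃ p q : ℝ, 0 < p * b m + q ∧ ∀ x, (∀ n, x ∉ gap a b n) → (x < b m ∨ β < x) →
      ∃ c > 0, (x - b m) * (comparisonPoly k k' (b m) β).eval x = c * (p * x + q) := by
  obtain ⟨B, R, hQ, hR0, hdeg, hB, hneg⟩ := exists_comparisonPoly_eq_mul h hβ h' hk hk'
  have hgl : Function.Injective (gapLeft : Fin (d - 1) → Fin d) := fun n l hnl => by
    simpa [gapLeft, Fin.ext_iff] using hnl
  have hcard : (Finset.univ.filter fun n : Fin (d - 1) => gapLeft n ≠ m).card = d - 1 - 1 := by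
    have : (Finset.univ.filter fun n : Fin (d - 1) => gapLeft n ≠ m) = Finset.univ.erase i := by
      ext n
      simp [← hi, hgl.ne_iff]
    rw [this, Finset.card_erase_of_mem (Finset.mem_univ _), Finset.card_univ, Fintype.card_fin]
  rw [hcard] at hdeg
  -- The existence of i gives d ≥ 2, so the truncated subtraction d − 1 − 1 is exact in the degree
  -- count.
  have hi2 := i.2
  obtain ⟨r, hr, hkr⟩ := hk.exists_roots h
  obtain ⟨r', hr', hkr'⟩ := hk'.exists_roots h'
  have hr'' : ∀ n, r' n ∈ gap a b n := fun n => gap_update_subset hβ n (hr' n)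
  have hb' : Function.update b m β (gapLeft i) = β := by rw [hi, Function.update_self]
  have hβa : β < a (gapRight i) := by
    have := h'.gap_lt i
    rwa [hb'] at this
  have hba : b m < a (gapRight i) := hβ.trans hβa
  -- At β only the k' term survives; at the right end both terms have the sign of k'. As k' changes
  -- sign across the shortened gap, so does the sum.
  obtain ⟨y, hy, hyQ⟩ : ∃ y ∈ Set.Ioo β (a (gapRight i)),
      k.eval y * √|y - β| + k'.eval y * √|y - b m| = 0 := by
    refine exists_zero_of_mul_neg hβa
      (f := fun x => k.eval x * √|x - β| + k'.eval x * √|x - b m|) (by fun_prop) ?_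
    have hneg' := eval_gap_ends_mul_neg h' hr' i
    rw [← hkr', hb'] at hneg'
    have hpos := eval_mul_eval_pos hr hr'' (h.gapRight_notMem_gap i)
    rw [← hkr, ← hkr'] at hpos
    have s1 : 0 < √|β - b m| := Real.sqrt_pos.2 (abs_pos.2 (by linarith))
    have s2 : 0 < √|a (gapRight i) - b m| := Real.sqrt_pos.2 (abs_pos.2 (by linarith))
    have s3 : 0 ≤ √|a (gapRight i) - β| := Real.sqrt_nonneg _
    have hsame : k'.eval β * k.eval (a (gapRight i)) < 0 := by
      by_contra! hge
      have h1 := mul_nonneg hge hpos.le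
      have h2 : 0 < k.eval (a (gapRight i)) ^ 2 := by
        have := left_ne_zero_of_mul hpos.ne'
        positivity
      nlinarith
    have t1 : k'.eval β * √|β - b m| * (k.eval (a (gapRight i)) * √|a (gapRight i) - β|) ≤ 0 := by
      have := mul_nonneg s1.le s3
      nlinarith
    have t2 : k'.eval β * √|β - b m| * (k'.eval (a (gapRight i)) * √|a (gapRight i) - b m|) < 0 := by
      have := mul_pos s1 s2
      nlinarith
    simp only [sub_self, abs_zero, Real.sqrt_zero, mul_zero, zero_add, mul_add]
    linarith
  have hyroot : (comparisonPoly k k' (b m) β).IsRoot y :=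
    comparisonPoly_isRoot_of_sq_eq hβ (Or.inr hy.1) (by
      rw [eq_neg_of_add_eq_zero_left hyQ, neg_sq])
  have hygap : y ∈ gap a b i := ⟨by rw [hi]; exact hβ.trans hy.1, hy.2⟩
  have hyR : R.eval y = 0 := by
    rw [hQ, IsRoot.def, eval_mul] at hyroot
    refine (mul_eq_zero.1 hyroot).resolve_left (hB y fun n hn hyn => ?_).ne'
    refine h.disjoint_gap (fun hni => hn ?_) hyn hygap rfl
    rw [hni, hi]
  obtain ⟨S, hS⟩ := dvd_iff_isRoot.2 hyR
  have hS0 : S ≠ 0 := fun h0 => hR0 (by rw [hS, h0, mul_zero])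
  have hSdeg : S.natDegree ≤ 1 := by
    rw [hS, (monic_X_sub_C y).natDegree_mul' hS0, natDegree_X_sub_C] at hdeg
    omega
  obtain ⟨p, q, hpq⟩ := exists_eq_X_add_C_of_natDegree_le_one hSdeg
  have hSe : ∀ x, S.eval x = p * x + q := fun x => by rw [hpq]; simp
  have hRe : ∀ x, R.eval x = (x - y) * (p * x + q) := fun x => by rw [hS]; simp [hSe]
  refine ⟨p, q, ?_, fun x hx hxo => ⟨B.eval x * ((x - b m) * (x - y)), ?_, ?_⟩⟩
  · rw [hRe] at hneg
    have : b m - y < 0 := by linarith [hy.1]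
    exact pos_of_mul_neg_right hneg this.le
  · refine mul_pos (hB x fun n _ => hx n) ?_
    rcases hxo with hxo | hxo
    · exact mul_pos_of_neg_of_neg (by linarith) (by linarith [hy.1])
    · have : a (gapRight i) ≤ x := by
        by_contra! hlt
        exact hx i ⟨by rw [hi]; exact hβ.trans hxo, hlt⟩
      exact mul_pos (by linarith) (by linarith [hy.2])
  · rw [hQ, eval_mul, hRe]
    ring

theorem density_lt_of_move (hd : 1 ≤ d) (h : IsIntervalSystem a b) (hβ : b m < β)
    (h' : IsIntervalSystem a (Function.update b m β)) {k k' : ℝ[X]} (hk : IsEtaNumerator a b k)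
    (hk' : IsEtaNumerator a (Function.update b m β) k') {j : Fin d} (hj : j ≠ m) {x : ℝ}
    (hx : x ∈ Set.Ioo (a j) (b j)) :
    |k'.eval x| / √|(endpointPoly a (Function.update b m β)).eval x| <
      |k.eval x| / √|(endpointPoly a b).eval x| := by
  have hxI : x ∈ Set.Icc (a j) (b j) := ⟨hx.1.le, hx.2.le⟩
  have hxo := outside_of_mem_Icc_of_ne h h' hj hxI
  have hxg := h.notMem_gap_of_mem_Icc hxI
  refine (density_lt_of_sub_mul_comparisonPoly hβ hxo (h.eval_endpointPoly_ne_zero_of_mem_Ioo hx)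
    (h'.eval_endpointPoly_ne_zero_of_mem_Ioo (j := j) (by rwa [Function.update_of_ne hj]))).1 ?_
  by_cases hm : ∀ n, gapLeft n ≠ m
  · refine sub_mul_comparisonPoly_pos_of_last h hβ h' hk hk' hm ?_ hxg
    refine hx.2.trans (h.right_strictMono (lt_of_le_of_ne ?_ hj))
    by_contra! hlt
    rw [Fin.lt_def] at hlt
    exact hm ⟨m, by omega⟩ rfl
  push Not at hm
  obtain ⟨i, hi⟩ := hm
  obtain ⟨p, q, hpq, hsign⟩ := exists_affine_sign h hβ h' hk hk' hi
  obtain ⟨c, hc, hcx⟩ := hsign x hxg hxo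
  rw [hcx]
  refine mul_pos hc ?_
  -- A value ≤ 0 at x and > 0 at b_m gives the affine function opposite strict signs on the two
  -- sides of the hull, since x and b_m both lie inside it.
  by_contra! hle
  -- The moved interval is not the last, so the hull is unchanged and the outer integrals can be
  -- compared.
  have hmlt : m ≠ ⟨d - 1, by omega⟩ := by
    rw [← hi]
    simp only [gapLeft, ne_eq, Fin.mk.injEq]
    omega
  have hlast : Function.update b m β ⟨d - 1, by omega⟩ = b ⟨d - 1, by omega⟩ :=
    Function.update_of_ne hmlt.symm _ _
  have hβlast : β ≤ b ⟨d - 1, by omega⟩ := by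
    have := h'.right_le_last hd m
    rwa [Function.update_self, hlast] at this
  have hbm := (h.first_le_left hd m).trans_lt (h.1 m)
  have hxl := hx.2.trans_le (h.right_le_last hd j)
  have hxr := (h.first_le_left hd j).trans_lt hx.1
  have houter : ∀ z, z < a ⟨0, by omega⟩ ∨ b ⟨d - 1, by omega⟩ < z →
      (0 < p * z + q → 0 < |k.eval z| / √|(endpointPoly a b).eval z| -
        |k'.eval z| / √|(endpointPoly a (Function.update b m β)).eval z|) ∧
      (p * z + q < 0 → |k.eval z| / √|(endpointPoly a b).eval z| -
        |k'.eval z| / √|(endpointPoly a (Function.update b m β)).eval z| < 0) := by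
    intro z hz
    have hzN : ∀ {b : Fin d → ℝ}, IsIntervalSystem a b →
        (z < a ⟨0, by omega⟩ ∨ b ⟨d - 1, by omega⟩ < z) → (endpointPoly a b).eval z ≠ 0 := by
      intro b h hz
      refine eval_endpointPoly_ne_zero_iff.2 fun l => ?_
      have h1 := h.1 l
      rcases hz with hz | hz
      · have := h.first_le_left hd l
        exact ⟨by linarith, by linarith⟩
      · have := h.right_le_last hd l
        exact ⟨by linarith, by linarith⟩
    have hzo : z < b m ∨ β < z := hz.imp (fun h => h.trans hbm) fun h => hβlast.trans_lt h
    have hzg : ∀ n, z ∉ gap a b n := fun n hn => by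
      have := h.gap_subset_hull hd hn
      rcases hz with hz | hz
      · exact absurd hz this.1.not_gt
      · exact absurd hz this.2.not_gt
    obtain ⟨c, hc, hcz⟩ := hsign z hzg hzo
    have := density_lt_of_sub_mul_comparisonPoly (k := k) (k' := k') hβ hzo (hzN h hz)
      (hzN h' (by rwa [hlast]))
    rw [hcz] at this
    exact ⟨fun h0 => sub_pos.2 (this.1 (mul_pos hc h0)),
      fun h0 => sub_neg.2 (this.2 (mul_neg_of_pos_of_neg hc h0))⟩
  rcases hxo with hxo | hxo
  · have hp : 0 < p := by
      by_contra! hp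
      nlinarith
    refine not_outer_sign_change hd h h' hlast hk hk' (σ := 1) (fun z hz => ?_) fun z hz => ?_
    · rw [one_mul]
      refine (houter z (Or.inr hz)).1 ?_
      nlinarith
    · rw [one_mul]
      refine (houter z (Or.inl hz)).2 ?_
      nlinarith
  · have hp : p < 0 := by
      by_contra! hp
      nlinarith
    refine not_outer_sign_change hd h h' hlast hk hk' (σ := -1) (fun z hz => ?_) fun z hz => ?_
    · rw [neg_one_mul, neg_pos]
      refine (houter z (Or.inr hz)).2 ?_
      nlinarith
    · rw [neg_one_mul, neg_neg_iff_pos]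
      refine (houter z (Or.inl hz)).1 ?_
      nlinarith

end Move

/-! ### From densities to masses, and extension of several intervals -/

theorem equilibriumMeasure_real_Icc {d : ℕ} {a b : Fin d → ℝ} (h : IsIntervalSystem a b)
    (j : Fin d) :
    IntervalIntegrable (fun x => Real.pi⁻¹ *
      (|(etaNumerator a b).eval x| / √|(endpointPoly a b).eval x|)) volume (a j) (b j) ∧
    (equilibriumMeasure a b).real (Set.Icc (a j) (b j)) = ∫ x in (a j)..(b j), Real.pi⁻¹ *
      (|(etaNumerator a b).eval x| / √|(endpointPoly a b).eval x|) := by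
  have hint : IntervalIntegrable (fun x => Real.pi⁻¹ *
      (|(etaNumerator a b).eval x| / √|(endpointPoly a b).eval x|)) volume (a j) (b j) := by
    simp only [div_eq_mul_inv]
    refine IntervalIntegrable.const_mul (IntervalIntegrable.continuousOn_mul ?_ (by fun_prop)) _
    exact intervalIntegrable_iff.2 ((LocallyIntegrable.integrableOn_isCompact
      (locallyIntegrable_inv_sqrt_endpointPoly h) isCompact_uIcc).mono_set Set.uIoc_subset_uIcc)
  refine ⟨hint, ?_⟩
  have hint' := (intervalIntegrable_iff_integrableOn_Icc_of_le (h.1 j).le).1 hint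
  rw [intervalIntegral.integral_of_le (h.1 j).le, ← integral_Icc_eq_integral_Ioc,
    integral_eq_lintegral_of_nonneg_ae (Eventually.of_forall fun x => by positivity)
      hint'.aestronglyMeasurable, Measure.real, equilibriumMeasure,
    withDensity_apply _ measurableSet_Icc, Measure.restrict_restrict measurableSet_Icc,
    Set.inter_eq_left.2 (Set.subset_iUnion (fun j => Set.Icc (a j) (b j)) j)]

theorem equilibriumMeasure_real_lt_of_move {d : ℕ} {a b : Fin d → ℝ} {m : Fin d} {β : ℝ}
    (h : IsIntervalSystem a b) (hβ : b m < β) (h' : IsIntervalSystem a (Function.update b m β))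
    {j : Fin d} (hj : j ≠ m) :
    (equilibriumMeasure a (Function.update b m β)).real (Set.Icc (a j) (b j)) <
      (equilibriumMeasure a b).real (Set.Icc (a j) (b j)) := by
  obtain ⟨i1, e1⟩ := equilibriumMeasure_real_Icc h j
  obtain ⟨i2, e2⟩ := equilibriumMeasure_real_Icc h' j
  rw [Function.update_of_ne hj] at i2 e2
  rw [e1, e2, ← sub_pos, ← intervalIntegral.integral_sub i1 i2]
  refine intervalIntegral.intervalIntegral_pos_of_pos_on (i1.sub i2) (fun x hx => ?_) (h.1 j)
  have := density_lt_of_move (by have := j.2; omega) h hβ h' (isEtaNumerator_etaNumerator h)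
    (isEtaNumerator_etaNumerator h') hj hx
  exact sub_pos.2 (mul_lt_mul_of_pos_left this (inv_pos.2 Real.pi_pos))

/-- An arbitrary set of extended intervals is allowed because the extensions are carried out one
after another, and each intermediate set must again be an interval system. -/
theorem AdmissibleBribes.isIntervalSystem {d : ℕ} {a b t : Fin d → ℝ}
    (hE : IsIntervalSystem a b) (ht : AdmissibleBribes a b t) (s : Finset (Fin d)) :
    IsIntervalSystem a fun l => if l ∈ s then b l + t l else b l := by
  constructor
  · intro l
    have := hE.1 l
    have := (ht l).1
    dsimp only
    split_ifs <;> linarith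
  · intro i l hil
    have hlt := hE.2 i l hil
    dsimp only
    split_ifs
    · have hi : (i : ℕ) + 1 < d := by rw [Fin.lt_def] at hil; omega
      have h1 := (ht i).2 i ⟨i + 1, hi⟩ rfl
      have h2 : a ⟨i + 1, hi⟩ ≤ a l :=
        hE.left_strictMono.monotone (by rw [Fin.lt_def] at hil; rw [Fin.le_def]; exact hil)
      have h3 := (ht i).1
      linarith
    · exact hlt

/-- The mass of an interval that stays fixed drops when other intervals are extended. -/
theorem equilibriumMeasure_real_lt_of_extend {d : ℕ} {a b t : Fin d → ℝ}
    (hE : IsIntervalSystem a b) (ht : AdmissibleBribes a b t) {j : Fin d} (s : Finset (Fin d))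
    (hjs : j ∉ s) (hs : ∀ l ∈ s, 0 < t l) (hne : s.Nonempty) :
    (equilibriumMeasure a fun l => if l ∈ s then b l + t l else b l).real (Set.Icc (a j) (b j)) <
      (equilibriumMeasure a b).real (Set.Icc (a j) (b j)) := by
  induction hne using Finset.Nonempty.cons_induction with
  | singleton m =>
    have e : (fun l => if l ∈ ({m} : Finset (Fin d)) then b l + t l else b l) =
        Function.update b m (b m + t m) := by
      ext l
      rcases eq_or_ne l m with rfl | hl <;> simp [*]
    have h' := ht.isIntervalSystem hE {m}
    rw [e] at h' ⊢
    have := hs m (Finset.mem_singleton_self m)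
    exact equilibriumMeasure_real_lt_of_move hE (by linarith) h'
      fun hjm => hjs (Finset.mem_singleton.2 hjm)
  | cons m s hm _ ih =>
    have hjm : j ≠ m := fun hjm => hjs (by simp [hjm])
    have hjs' : j ∉ s := fun hj => hjs (by simp [hj])
    -- The mass drops strictly from b to the partially extended b₁, by induction, and again when
    -- endpoint m is moved on top of b₁.
    refine lt_trans ?_ (ih hjs' fun l hl => hs l (by simp [hl]))
    set b₁ : Fin d → ℝ := fun l => if l ∈ s then b l + t l else b l with hb₁
    have e : (fun l => if l ∈ Finset.cons m s hm then b l + t l else b l) =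
        Function.update b₁ m (b m + t m) := by
      ext l
      rcases eq_or_ne l m with rfl | hl <;> simp [*]
    have h' := ht.isIntervalSystem hE (Finset.cons m s hm)
    have hj : b₁ j = b j := if_neg hjs'
    have hbm : b₁ m = b m := if_neg hm
    rw [e] at h' ⊢
    have := hs m (by simp)
    have h₁ : IsIntervalSystem a b₁ := ht.isIntervalSystem hE s
    have key := equilibriumMeasure_real_lt_of_move h₁ (by rw [hbm]; linarith) h' hjm
    rwa [hj] at key

theorem mainTheorem8 {d : ℕ} (hd : 2 ≤ d) (a b : Fin d → ℝ) (hE : IsIntervalSystem a b)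
    (t : Fin d → ℝ) (ht : AdmissibleBribes a b t) (hfix : ∃ j, t j = 0) :
    IsFairSolution a b t ↔ t = 0 := by
  refine ⟨fun hfair => ?_, fun h0 j => by rw [h0]⟩
  obtain ⟨j, hj⟩ := hfix
  by_contra hne
  obtain ⟨m, hm⟩ := Function.ne_iff.1 hne
  have hmpos : 0 < t m := lt_of_le_of_ne (ht m).1 (Ne.symm hm)
  have hlt := equilibriumMeasure_real_lt_of_extend hE ht (j := j)
    (Finset.univ.filter fun l => 0 < t l) (by simp [hj]) (by simp) ⟨m, by simpa using hmpos⟩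
  have e : (fun l => if l ∈ Finset.univ.filter (fun l => 0 < t l) then b l + t l else b l) =
      b + t := by
    ext l
    by_cases hl : 0 < t l
    · simp [hl]
    · have : t l = 0 := le_antisymm (not_lt.1 hl) (ht l).1
      simp [this]
  have hshare := hfair j
  rw [share, share, hj, add_zero, add_zero, Pi.zero_apply, add_zero] at hshare
  rw [e, hshare] at hlt
  exact lt_irrefl _ hlt
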